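/- **Setting.** A stochastic shortest path (SSP) instance $M$ with $S$ states and $A$ actions consists of an initial state $s_{\mathrm{init}}$, a cost function $c:[S]\times[A]\to[0,1]$ and transition probabilities $P(\cdot\mid s,a)$ on $[S]\cup\{g\}$, where $g$ is an absorbing cost-free goal. A policy is a sequence of (possibly stochastic) decision rules, one for each time step; it is stationary if this sequence is constant. For a policy $\pi$, $V^\pi(s)$ and $T^\pi(s)$ in $[0,\infty]$ are the expected total cost and the expected number of steps until $g$ is reached from $s$. A stationary policy is proper if $T^\pi(s)<\infty$ for all $s$. Let $V^\star(s)=\inf V^\pi(s)$ over stationary proper policies, $B_\star=\max_s V^\star(s)$, and let $T_\star=\max_s T^{\pi^\star}(s)$, where $\pi^\star$ is a deterministic stationary proper policy with $V^{\pi^\star}=V^\star$ (the one with the largest value of $T_\star$ if it is not unique). A policy $\pi$ is $\epsilon$-optimal if $V^{\pi}(s_{\mathrm{init}})\le V^\star(s_{\mathrm{init}})+\epsilon$. For $c_{\min}\ge 0$ and $\overline T\in[0,\infty]$ let $\mathcal C(S,A,c_{\min},\overline T)$ be the set of SSP instances with $S$ states and $A$ actions that have a proper policy, satisfy $\min_{s,a}c(s,a)=c_{\min}$,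 and satisfy $T_\star\le\overline T$ (where $\overline T=\infty$ means that no bound on $T_\star$ is known). A learning algorithm knows $s_{\mathrm{init}}$ and $c$, but not $P$. It adaptively and possibly randomly queries a generative model, each call with a pair $(s,a)$ returning an independent sample from $P(\cdot\mid s,a)$, until it stops and returns a policy. It is $(\epsilon,\delta)$-correct on $\mathcal C$ with sample complexity $n:\mathcal C\to\mathbb N\cup\{\infty\}$ if, on every $M\in\mathcal C$, with probability at least $1-\delta$ it stops after at most $n(M)$ calls (after finitely many, if $n(M)=\infty$) and returns an $\epsilon$-optimal policy. **Theorem.** There is a universal constant $\kappa>0$ such that the following holds. Let $S\ge 2$, $A\ge 3$, $c_{\min}\ge 0$, $B\ge 2$, $T_0\ge\max\{B,\log_A S+1\}$ and $\overline T\in[0,\infty]$ satisfy $c_{\min}\le B/T_0$ and $\overline T\ge 2T_0$, and suppose that $c_{\min}>0$ or $\overline T<\infty$. Let $\epsilon\in(0,\frac1{32})$ and $\delta\in(0,\frac1{2e^4})$. Then there is an instance $M_0\in\mathcal C(S,A,c_{\min},\overline T)$ with $\frac B2\le B_\star(M_0)\le 2B$ and $\frac{T_0}2\le T_\star(M_0)\le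 2T_0$ such that, for every algorithm that is $(\epsilon,\delta)$-correct on $\mathcal C(S,A,c_{\min},\overline T)$ with sample complexity $n$, $$ n(M_0)\ \ge\ \kappa\,\min\Big\{\frac{B_\star(M_0)}{c_{\min}},\ \overline T\Big\}\,\frac{B_\star(M_0)^2\,S\,A}{\epsilon^2}\,\ln\frac1\delta, $$ where $B_\star(M_0)/c_{\min}=\infty$ if $c_{\min}=0$. In particular, with $\overline T=\infty$ and $c_{\min}>0$, one has $n(M_0)\ge\kappa\,\frac{B_\star(M_0)^3SA}{c_{\min}\epsilon^2}\ln\frac1\delta$. -/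

import Mathlib

open scoped ENNReal

/-- A stochastic shortest path (SSP) instance with state space `Fin S`, action space `Fin A` and
an additional goal state, written `none : Option (Fin S)`. The goal is absorbing and free of cost;
costs of the other states lie in `[0, 1]`. -/
structure SSP (S A : ℕ) where
  init : Fin S
  cost : Fin S → Fin A → ℝ
  trans : Fin S → Fin A → PMF (Option (Fin S))
  cost_nonneg : ∀ s a, 0 ≤ cost s a
  cost_le_one : ∀ s a, cost s a ≤ 1

/-- A (possibly stochastic) stationary decision rule: a distribution over actions in each state. -/
abbrev DecisionRule (S A : ℕ) : Type := Fin S → stdSimplex ℝ (Fin A)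

/-- A (possibly stochastic, possibly non-stationary) policy: a decision rule for each time step.
A stationary policy is a constant sequence `fun _ => π`. -/
abbrev SSPPolicy (S A : ℕ) : Type := ℕ → DecisionRule S A

/-- The stationary deterministic decision rule given by a map from states to actions. -/
noncomputable def detRule {S A : ℕ} (f : Fin S → Fin A) : DecisionRule S A :=
  fun s => ⟨Pi.single (f s) 1, single_mem_stdSimplex ℝ (f s)⟩

namespace SSP

variable {S A : ℕ}

/-- The expected value of the sum of `r (s_t) (a_t)` over the first `n` time steps `t` at which the
goal has not been reached yet, when starting in `s` and following `π`. -/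
noncomputable def expSum (M : SSP S A) (r : Fin S → Fin A → ℝ≥0∞) :
    ℕ → SSPPolicy S A → Fin S → ℝ≥0∞
  | 0, _, _ => 0
  | n + 1, π, s => ∑ a, ENNReal.ofReal ((π 0 s : Fin A → ℝ) a) *
      (r s a + ∑ s' : Fin S, M.trans s a (some s') * expSum M r n (fun t => π (t + 1)) s')

/-- The value function `V^π(s)`: expected total cost until the goal is reached. -/
noncomputable def value (M : SSP S A) (π : SSPPolicy S A) (s : Fin S) : ℝ≥0∞ :=
  ⨆ n, M.expSum (fun u a => ENNReal.ofReal (M.cost u a)) n π s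

/-- The hitting time `T^π(s)`: expected number of steps until the goal is reached. -/
noncomputable def hittingTime (M : SSP S A) (π : SSPPolicy S A) (s : Fin S) : ℝ≥0∞ :=
  ⨆ n, M.expSum (fun _ _ => 1) n π s

/-- A stationary policy is proper if it has finite expected hitting time from every state
(for stationary policies: if it reaches the goal with probability one from every state). -/
def Proper (M : SSP S A) (π : DecisionRule S A) : Prop :=
  ∀ s, M.hittingTime (fun _ => π) s < ⊤

/-- The optimal value `V⋆(s)` over stationary proper policies. -/
noncomputable def optValue (M : SSP S A) (s : Fin S) : ℝ≥0∞ :=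
  ⨅ (π : DecisionRule S A) (_ : M.Proper π), M.value (fun _ => π) s

/-- `B⋆`: maximum over all states of the optimal expected cost. -/
noncomputable def Bstar (M : SSP S A) : ℝ≥0∞ := ⨆ s, M.optValue s

/-- A deterministic stationary policy that is an optimal proper policy (from every state). -/
def IsOptimal (M : SSP S A) (f : Fin S → Fin A) : Prop :=
  M.Proper (detRule f) ∧ ∀ s, M.value (fun _ => detRule f) s = M.optValue s

/-- `T⋆`: maximum over all states of the expected hitting time of the optimal policy. If the
optimal deterministic stationary policy is not unique, the one with the largest value counts. -/
noncomputable def Tstar (M : SSP S A) : ℝ≥0∞ :=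
  ⨆ (f : Fin S → Fin A) (_ : M.IsOptimal f) (s : Fin S), M.hittingTime (fun _ => detRule f) s

/-- `cmin` is the minimum cost over all state-action pairs. -/
def HasMinCost (M : SSP S A) (cmin : ℝ) : Prop :=
  IsLeast (Set.range fun x : Fin S × Fin A => M.cost x.1 x.2) cmin

/-- `π` is `ε`-optimal: `V^π(s_init) ≤ V⋆(s_init) + ε`. -/
def IsEpsOptimal (M : SSP S A) (ε : ℝ) (π : SSPPolicy S A) : Prop :=
  M.value π M.init ≤ M.optValue M.init + ENNReal.ofReal ε

end SSP

/-- One call to the generative model: the queried state-action pair and the sampled next state. -/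
abbrev Sample (S A : ℕ) : Type := (Fin S × Fin A) × Option (Fin S)

/-- A (randomized, adaptive) learning algorithm with access to a generative model. It knows the
initial state and the cost function, but not the transition function. Given the list of samples
collected so far (in chronological order), it randomly decides either to query the generative model
at a state-action pair (`Sum.inl`), or to stop and return a policy (`Sum.inr`). -/
structure LearningAlgorithm (S A : ℕ) where
  decide : Fin S → (Fin S → Fin A → ℝ) → List (Sample S A) →
    MeasureTheory.Measure ((Fin S × Fin A) ⊕ SSPPolicy S A)
  isProb : ∀ s₀ c h, MeasureTheory.IsProbabilityMeasure (decide s₀ c h)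

namespace LearningAlgorithm

variable {S A : ℕ}

/-- The law of the next decision of the algorithm on instance `M` after the samples `h`. -/
noncomputable def decideOn (alg : LearningAlgorithm S A) (M : SSP S A) (h : List (Sample S A)) :
    MeasureTheory.Measure ((Fin S × Fin A) ⊕ SSPPolicy S A) :=
  alg.decide M.init M.cost h

/-- The probability that, on instance `M`, the algorithm makes at least `h.length` calls to the
generative model and its first `h.length` samples are `h`. -/
noncomputable def transcriptProb (alg : LearningAlgorithm S A) (M : SSP S A)
    (h : List (Sample S A)) : ℝ≥0∞ :=
  ∏ i : Fin h.length, alg.decideOn M (h.take i) {Sum.inl (h.get i).1} *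
    M.trans (h.get i).1.1 (h.get i).1.2 (h.get i).2

/-- The probability that, on instance `M`, the algorithm stops after at most `n` calls to the
generative model (after finitely many, if `n = ⊤`) and returns a policy in `G`. -/
noncomputable def outputProb (alg : LearningAlgorithm S A) (M : SSP S A) (n : ℕ∞)
    (G : Set (SSPPolicy S A)) : ℝ≥0∞ :=
  ∑' h : {h : List (Sample S A) // (h.length : ℕ∞) ≤ n},
    alg.transcriptProb M h * alg.decideOn M h (Sum.inr '' G)

/-- The algorithm is `(ε, δ)`-correct on the class `C` of instances with sample complexity `n`:
on every instance `M` in `C`, with probability at least `1 - δ`, it stops after at most `n M`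
calls to the generative model and returns an `ε`-optimal policy. The value `n M = ⊤` only
requires that the algorithm stops. -/
def IsCorrect (alg : LearningAlgorithm S A) (ε δ : ℝ) (C : Set (SSP S A))
    (n : SSP S A → ℕ∞) : Prop :=
  ∀ M ∈ C, ENNReal.ofReal (1 - δ) ≤ alg.outputProb M (n M) {π | M.IsEpsOptimal ε π}

end LearningAlgorithm

/-- The instances with minimum cost `cmin` that have a proper policy and satisfy `T⋆ ≤ Tbar`.
The case `Tbar = ⊤` means that no bound on `T⋆` is known. -/
def sspClass (S A : ℕ) (cmin : ℝ) (Tbar : ℝ≥0∞) : Set (SSP S A) :=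
  {M | (∃ π, M.Proper π) ∧ M.HasMinCost cmin ∧ M.Tstar ≤ Tbar}

/-! The hard instances form an `A`-ary heap on all states but one. The remaining state, the sink,
costs `B / T` per step and is left with probability `1 / T`, so it has value `B`. Inner nodes move
deterministically to a child. In a leaf the fast action leaves at once, while every other (slow)
action waits a geometric time with mean `T₁`, of order `K`, where `K` stands for `min (B / cmin)
Tbar`. On leaving, it fails into the sink with probability `slowProb` and otherwise reaches the
goal. The larger failure probability `fastProb` offsets the saved waiting cost up to `3ε`, so that
the fast action wins by exactly `3ε`. Lowering the failure probability of one slow pair by `6ε / B`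
makes that pair win by `3ε` instead. The term `lack s * cmin / B` in `slowProb` makes all leaves
equally good as seen from the root, so an improvement at any leaf is an improvement at the root.

Two facts carry the bound. First, no policy, even a non-stationary stochastic one, is `ε`-optimal
both before and after the perturbation (`disjoint_isEpsOptimal`). The expected sums are affine in
the perturbation, and at half of it the unperturbed optimal value `W` is still a lower bound for
every policy. The two values thus add up to at least `2W`, whereas `ε`-optimality on both instances
would give at most `2W - ε`. Second, a query of a slow pair is informative only with probability `1
/ T₁`: staying put is equally likely in both instances. The relative entropy per query is therefore
of order `ε² / (B² T₁)` (`sum_logRatio_le`).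

A change of measure (`log_mul_sub_le`) then forces order `T₁ B² / ε² · ln (1/δ)` expected queries of
each slow pair on the unperturbed instance, and there are at least `S A / 6` such pairs. The hitting
time `Tstar` of that instance is nevertheless of order `T`, because its optimal policies never use
slow actions in the leaves. -/

theorem sum_ofReal_stdSimplex {A : ℕ} (ρ : stdSimplex ℝ (Fin A)) :
    ∑ a, ENNReal.ofReal ((ρ : Fin A → ℝ) a) = 1 := by
  have h : ∑ a, (ρ : Fin A → ℝ) a = 1 := ρ.2.2
  rw [← ENNReal.ofReal_sum_of_nonneg (f := ρ) (fun a _ => ρ.2.1 a), h, ENNReal.ofReal_one]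

/-! ### Bellman inequalities for arbitrary policies -/

namespace SSP

variable {S A : ℕ}

/-- A function that dominates its Bellman update along `π` dominates the expected sums. -/
theorem expSum_le (M : SSP S A) (r : Fin S → Fin A → ℝ≥0∞) (U : Fin S → ℝ≥0∞) (n : ℕ) :
    ∀ (π : SSPPolicy S A) (s : Fin S),
      (∀ t s a, (π t s : Fin A → ℝ) a ≠ 0 →
        r s a + ∑ s', M.trans s a (some s') * U s' ≤ U s) →
      M.expSum r n π s ≤ U s := by
  induction n with
  | zero => intro π s _; simp [expSum]
  | succ n ih =>
    intro π s h
    calc M.expSum r (n + 1) π s ≤ ∑ a, ENNReal.ofReal ((π 0 s : Fin A → ℝ) a) * U s := by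
          refine Finset.sum_le_sum fun a _ => ?_
          by_cases ha : (π 0 s : Fin A → ℝ) a = 0
          · simp [ha]
          · refine mul_le_mul_right (le_trans ?_ (h 0 s a ha)) _
            gcongr
            exact ih _ _ fun t => h (t + 1)
      _ = U s := by rw [← Finset.sum_mul, sum_ofReal_stdSimplex, one_mul]

/-- A function that is dominated by its Bellman update along `π` is dominated by the expected
sums, up to an error that contracts with the function `H`. -/
theorem le_expSum_add (M : SSP S A) (r : Fin S → Fin A → ℝ≥0∞) (Φ H : Fin S → ℝ≥0∞)
    (ρ C : ℝ≥0∞) (hH : ∀ s a, ∑ s', M.trans s a (some s') * H s' ≤ ρ * H s)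
    (hC : ∀ s, Φ s ≤ C * H s) (n : ℕ) :
    ∀ (π : SSPPolicy S A) (s : Fin S),
      (∀ t s a, (π t s : Fin A → ℝ) a ≠ 0 →
        Φ s ≤ r s a + ∑ s', M.trans s a (some s') * Φ s') →
      Φ s ≤ M.expSum r n π s + C * ρ ^ n * H s := by
  induction n with
  | zero => intro π s _; simpa [expSum] using hC s
  | succ n ih =>
    intro π s h
    calc Φ s = ∑ a, ENNReal.ofReal ((π 0 s : Fin A → ℝ) a) * Φ s := by
          rw [← Finset.sum_mul, sum_ofReal_stdSimplex, one_mul]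
      _ ≤ ∑ a, ENNReal.ofReal ((π 0 s : Fin A → ℝ) a) * (r s a +
            ∑ s', M.trans s a (some s') * M.expSum r n (fun t => π (t + 1)) s'
            + C * ρ ^ (n + 1) * H s) := by
          refine Finset.sum_le_sum fun a _ => ?_
          by_cases ha : (π 0 s : Fin A → ℝ) a = 0
          · simp [ha]
          refine mul_le_mul_right (le_trans (h 0 s a ha) ?_) _
          rw [add_assoc]
          gcongr
          calc ∑ s', M.trans s a (some s') * Φ s'
              ≤ ∑ s', M.trans s a (some s') *
                  (M.expSum r n (fun t => π (t + 1)) s' + C * ρ ^ n * H s') := by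
                gcongr
                exact ih _ _ fun t => h (t + 1)
            _ = ∑ s', M.trans s a (some s') * M.expSum r n (fun t => π (t + 1)) s' +
                  C * ρ ^ n * ∑ s', M.trans s a (some s') * H s' := by
                rw [Finset.mul_sum, ← Finset.sum_add_distrib]
                exact Finset.sum_congr rfl fun _ _ => by ring
            _ ≤ ∑ s', M.trans s a (some s') * M.expSum r n (fun t => π (t + 1)) s' +
                  C * ρ ^ n * (ρ * H s) := by
                gcongr
                exact hH s a
            _ = _ := by ring
      _ = M.expSum r (n + 1) π s + C * ρ ^ (n + 1) * H s := by
          simp only [expSum, mul_add _ (_ + _), Finset.sum_add_distrib]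
          rw [← Finset.sum_mul, sum_ofReal_stdSimplex, one_mul]

/-- Let the horizon in `le_expSum_add` tend to infinity. Finiteness of `C` and `H` excludes the
product `∞ * 0` in the limit. -/
theorem le_iSup_expSum (M : SSP S A) (r : Fin S → Fin A → ℝ≥0∞) (Φ H : Fin S → ℝ≥0∞)
    (ρ C : ℝ≥0∞) (hρ : ρ < 1) (hCtop : C ≠ ⊤) (hHtop : ∀ s, H s ≠ ⊤)
    (hH : ∀ s a, ∑ s', M.trans s a (some s') * H s' ≤ ρ * H s)
    (hC : ∀ s, Φ s ≤ C * H s) (π : SSPPolicy S A) (s : Fin S)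
    (h : ∀ t s a, (π t s : Fin A → ℝ) a ≠ 0 →
      Φ s ≤ r s a + ∑ s', M.trans s a (some s') * Φ s') :
    Φ s ≤ ⨆ n, M.expSum r n π s := by
  have hlim : Filter.Tendsto (fun n => (⨆ n, M.expSum r n π s) + C * ρ ^ n * H s)
      Filter.atTop (nhds ((⨆ n, M.expSum r n π s) + C * 0 * H s)) := by
    refine tendsto_const_nhds.add (ENNReal.Tendsto.mul_const
      (ENNReal.Tendsto.const_mul (ENNReal.tendsto_pow_atTop_nhds_zero_of_lt_one hρ)
        (Or.inr hCtop)) (Or.inr (hHtop s)))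
  rw [mul_zero, zero_mul, add_zero] at hlim
  refine ge_of_tendsto' hlim fun n => ?_
  refine (M.le_expSum_add r Φ H ρ C hH hC n π s h).trans ?_
  gcongr
  exact le_iSup (fun n => M.expSum r n π s) n

/-- Needed to make the set of `ε`-optimal policies an event, so that the law of the output is
additive on disjoint sets of good policies. -/
theorem measurable_expSum (M : SSP S A) (r : Fin S → Fin A → ℝ≥0∞) (n : ℕ) :
    ∀ s, Measurable fun π : SSPPolicy S A => M.expSum r n π s := by
  induction n with
  | zero => intro s; simp only [expSum]; exact measurable_const
  | succ n ih =>
    intro s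
    simp only [expSum]
    refine Finset.measurable_sum _ fun a _ => Measurable.mul ?_ (measurable_const.add
      (Finset.measurable_sum _ fun s' _ => measurable_const.mul ((ih s').comp ?_)))
    · exact ENNReal.measurable_ofReal.comp ((measurable_pi_apply a).comp
        (measurable_subtype_coe.comp ((measurable_pi_apply s).comp (measurable_pi_apply 0))))
    · exact measurable_pi_iff.2 fun t => measurable_pi_apply (t + 1)

theorem measurableSet_isEpsOptimal (M : SSP S A) (ε : ℝ) :
    MeasurableSet {π | M.IsEpsOptimal ε π} :=
  measurableSet_le (Measurable.iSup fun n => M.measurable_expSum _ n _) measurable_const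

theorem Proper.optValue_le {M : SSP S A} {π : DecisionRule S A} (hπ : M.Proper π) (s : Fin S) :
    M.optValue s ≤ M.value (fun _ => π) s :=
  iInf₂_le π hπ

theorem eq_of_detRule_ne_zero {f : Fin S → Fin A} {s : Fin S} {a : Fin A}
    (h : (detRule f s : Fin A → ℝ) a ≠ 0) : a = f s := by
  by_contra hne
  exact h (Pi.single_eq_of_ne hne 1)

end SSP

/-! ### Transcripts of a given length -/

section Levels

variable {α : Type*} [Fintype α]

/-- Appending one entry to a list, as an embedding. -/
def snocEmbedding (α : Type*) : List α × α ↪ List α :=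
  ⟨fun x => x.1 ++ [x.2], by
    rintro ⟨l, a⟩ ⟨l', a'⟩ h
    have := List.append_inj' h rfl
    simp_all⟩

/-- The lists of length `k` over a finite type. -/
def listsOfLength (α : Type*) [Fintype α] : ℕ → Finset (List α)
  | 0 => {[]}
  | k + 1 => (listsOfLength α k ×ˢ Finset.univ).map (snocEmbedding α)

theorem sum_listsOfLength_succ {R : Type*} [AddCommMonoid R] (F : List α → R) (k : ℕ) :
    ∑ h ∈ listsOfLength α (k + 1), F h = ∑ h ∈ listsOfLength α k, ∑ z, F (h ++ [z]) := by
  rw [listsOfLength, Finset.sum_map, Finset.sum_product]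
  rfl

theorem mem_listsOfLength {k : ℕ} : ∀ {h : List α}, h ∈ listsOfLength α k ↔ h.length = k := by
  induction k with
  | zero => intro h; simp [listsOfLength]
  | succ k ih =>
    intro h
    simp only [listsOfLength, Finset.mem_map, Finset.mem_product, Finset.mem_univ, and_true,
      Prod.exists, ih]
    constructor
    · rintro ⟨l, z, hl, rfl⟩
      change (l ++ [z]).length = k + 1
      simp [hl]
    · intro hk
      have hne : h ≠ [] := by rintro rfl; simp at hk
      exact ⟨h.dropLast, h.getLast hne, by simp [hk], List.dropLast_append_getLast hne⟩

end Levels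

/-! ### Change of measure for adaptive queries -/

section Information

variable {X Y : Type*}

/-- `p h` is the probability of the transcript `h` when, after a transcript `h`, the pair `x` is
queried with probability `q h x` and answered according to `P x`. -/
structure IsTranscriptLaw (q : List (X × Y) → X → ℝ) (P : X → Y → ℝ)
    (p : List (X × Y) → ℝ) : Prop where
  nil : p [] = 1
  append : ∀ h z, p (h ++ [z]) = p h * (q h z.1 * P z.1 z.2)

namespace IsTranscriptLaw

variable {q : List (X × Y) → X → ℝ} {P P₀ P₁ : X → Y → ℝ} {p p₀ p₁ : List (X × Y) → ℝ}

theorem nonneg (hp : IsTranscriptLaw q P p) (hq : ∀ h x, 0 ≤ q h x) (hP : ∀ x y, 0 ≤ P x y)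
    (h : List (X × Y)) : 0 ≤ p h := by
  induction h using List.reverseRecOn with
  | nil => rw [hp.nil]; exact zero_le_one
  | append_singleton h z ih => rw [hp.append]; exact mul_nonneg ih (mul_nonneg (hq _ _) (hP _ _))

/-- The query probabilities cancel in the likelihood ratio because both laws share `q`; only the
answers contribute. -/
theorem eq_mul_exp (hp₀ : IsTranscriptLaw q P₀ p₀) (hp₁ : IsTranscriptLaw q P₁ p₁)
    {l : X → Y → ℝ} (hl : ∀ x y, P₁ x y = P₀ x y * Real.exp (-l x y)) (h : List (X × Y)) :
    p₁ h = p₀ h * Real.exp (-(h.map fun z => l z.1 z.2).sum) := by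
  induction h using List.reverseRecOn with
  | nil => simp [hp₀.nil, hp₁.nil]
  | append_singleton h z ih =>
    rw [hp₀.append, hp₁.append, ih, hl]
    simp only [List.map_append, List.sum_append, List.map_cons, List.map_nil, List.sum_singleton,
      neg_add, Real.exp_add]
    ring

variable [Fintype X] [Fintype Y]

/-- One-step conditional expectation. The case `F = 1` gives conservation of mass, the case `F = l`
the drift of the log-likelihood ratio. -/
theorem sum_append (hp : IsTranscriptLaw q P p) (F : X → Y → ℝ) (h : List (X × Y)) :
    ∑ z, p (h ++ [z]) * F z.1 z.2 = p h * ∑ x, q h x * ∑ y, P x y * F x y := by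
  simp only [hp.append, Fintype.sum_prod_type, Finset.mul_sum]
  exact Finset.sum_congr rfl fun x _ => Finset.sum_congr rfl fun y _ => by ring

/-- The mass of the transcripts stopped before time `n` and of those alive at time `n`. -/
theorem sum_stopped_add (hp : IsTranscriptLaw q P p) (hP : ∀ x, ∑ y, P x y = 1) (n : ℕ) :
    ∑ k ∈ Finset.range n, ∑ h ∈ listsOfLength (X × Y) k, p h * (1 - ∑ x, q h x) +
      ∑ h ∈ listsOfLength (X × Y) n, p h = 1 := by
  induction n with
  | zero => simp [listsOfLength, hp.nil]
  | succ n ih =>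
    rw [Finset.sum_range_succ, sum_listsOfLength_succ, add_assoc, ← Finset.sum_add_distrib]
    convert ih using 3 with h
    have := hp.sum_append (fun _ _ => 1) h
    simp only [mul_one, hP] at this
    rw [this]
    ring

/-- The expected log-likelihood ratio at time `n` is the expected information collected. -/
theorem sum_stopped_mul_sum_add (hp : IsTranscriptLaw q P p) (hP : ∀ x, ∑ y, P x y = 1)
    (l : X → Y → ℝ) (n : ℕ) :
    ∑ k ∈ Finset.range n, ∑ h ∈ listsOfLength (X × Y) k,
        p h * (1 - ∑ x, q h x) * (h.map fun z => l z.1 z.2).sum +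
      ∑ h ∈ listsOfLength (X × Y) n, p h * (h.map fun z => l z.1 z.2).sum =
    ∑ k ∈ Finset.range n, ∑ h ∈ listsOfLength (X × Y) k,
      p h * ∑ x, q h x * ∑ y, P x y * l x y := by
  induction n with
  | zero => simp [listsOfLength]
  | succ n ih =>
    rw [Finset.sum_range_succ, sum_listsOfLength_succ, Finset.sum_range_succ _ n, ← ih, add_assoc,
      add_assoc, ← Finset.sum_add_distrib, ← Finset.sum_add_distrib]
    congr 1
    refine Finset.sum_congr rfl fun h _ => ?_
    have h1 := hp.sum_append (fun _ _ => 1) h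
    have h2 := hp.sum_append l h
    simp only [mul_one, hP] at h1
    simp only [List.map_append, List.sum_append, List.map_cons, List.map_nil, List.sum_singleton,
      mul_add, Finset.sum_add_distrib, ← Finset.sum_mul]
    rw [h1, h2]
    ring

/-- The expected number of queries of `x` among the first `n` queries. -/
noncomputable def expectedQueries (q : List (X × Y) → X → ℝ) (p : List (X × Y) → ℝ) (n : ℕ)
    (x : X) : ℝ :=
  ∑ k ∈ Finset.range n, ∑ h ∈ listsOfLength (X × Y) k, p h * q h x

theorem sum_expectedQueries_le (hp : IsTranscriptLaw q P p) (hP : ∀ x, ∑ y, P x y = 1)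
    (hP0 : ∀ x y, 0 ≤ P x y) (hq : ∀ h x, 0 ≤ q h x) (hq1 : ∀ h, ∑ x, q h x ≤ 1) (n : ℕ) :
    ∑ x, expectedQueries q p n x ≤ n := by
  have hlevel : ∀ k, ∑ h ∈ listsOfLength (X × Y) k, p h ≤ 1 := fun k => by
    rw [← hp.sum_stopped_add hP k]
    refine le_add_of_nonneg_left (Finset.sum_nonneg fun k _ => Finset.sum_nonneg fun h _ =>
      mul_nonneg (hp.nonneg hq hP0 h) (sub_nonneg.2 (hq1 h)))
  calc ∑ x, expectedQueries q p n x
      = ∑ k ∈ Finset.range n, ∑ h ∈ listsOfLength (X × Y) k, p h * ∑ x, q h x := by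
        simp only [expectedQueries, Finset.mul_sum]
        rw [Finset.sum_comm]
        exact Finset.sum_congr rfl fun k _ => Finset.sum_comm
    _ ≤ ∑ k ∈ Finset.range n, (1 : ℝ) := by
        refine Finset.sum_le_sum fun k _ => le_trans (Finset.sum_le_sum fun h _ => ?_) (hlevel k)
        exact mul_le_of_le_one_right (hp.nonneg hq hP0 h) (hq1 h)
    _ = n := by simp

/-- The tangent inequality for `exp`, with equality at `L = log c`. -/
theorem add_sub_mul_exp_le {c L : ℝ} (hc : 0 < c) :
    Real.log c + 1 - c * Real.exp (-L) ≤ L := by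
  have h := Real.add_one_le_exp (Real.log c - L)
  rw [sub_eq_add_neg, Real.exp_add, Real.exp_log hc] at h
  linarith

/-- Change of measure: an event decided within `n` queries that has probability `e₀` under the
first law and `e₁` under the second one requires information. -/
theorem log_mul_sub_le (hp₀ : IsTranscriptLaw q P₀ p₀) (hp₁ : IsTranscriptLaw q P₁ p₁)
    (hP₀ : ∀ x, ∑ y, P₀ x y = 1) (hP₁ : ∀ x, ∑ y, P₁ x y = 1)
    (hP0 : ∀ x y, 0 ≤ P₀ x y) (hq : ∀ h x, 0 ≤ q h x)
    {l : X → Y → ℝ} (hl : ∀ x y, P₁ x y = P₀ x y * Real.exp (-l x y))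
    {d : List (X × Y) → ℝ} (hd0 : ∀ h, 0 ≤ d h) (hd : ∀ h, d h ≤ 1 - ∑ x, q h x)
    (n : ℕ) {c : ℝ} (hc : 0 < c) :
    Real.log c * ∑ k ∈ Finset.range (n + 1), ∑ h ∈ listsOfLength (X × Y) k, p₀ h * d h -
      (c - 1) * ∑ k ∈ Finset.range (n + 1), ∑ h ∈ listsOfLength (X × Y) k, p₁ h * d h ≤
    ∑ x, expectedQueries q p₀ n x * ∑ y, P₀ x y * l x y := by
  -- Split the weight `w` into `d h` and `w - d h`, and use the tangent inequality with `c` on the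
  -- first part and with `1` on the second. The terms `p₀ h * w` and `p₁ h * w` cancel after
  -- summation, since both laws have total mass one.
  have key : ∀ h w, d h ≤ w →
      p₀ h * w - p₁ h * w + (Real.log c * (p₀ h * d h) - (c - 1) * (p₁ h * d h)) ≤
        p₀ h * w * (h.map fun z => l z.1 z.2).sum := fun h w hw => by
    rw [hp₀.eq_mul_exp hp₁ hl h]
    set L := (h.map fun z => l z.1 z.2).sum
    have h1 := mul_le_mul_of_nonneg_left (add_sub_mul_exp_le (L := L) hc)
      (mul_nonneg (hp₀.nonneg hq hP0 h) (hd0 h))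
    have h2 := mul_le_mul_of_nonneg_left (add_sub_mul_exp_le (L := L) one_pos)
      (mul_nonneg (hp₀.nonneg hq hP0 h) (sub_nonneg.2 hw))
    rw [Real.log_one] at h2
    linarith
  have hd1 : ∀ h, d h ≤ 1 := fun h =>
    (hd h).trans (sub_le_self _ (Finset.sum_nonneg fun x _ => hq h x))
  have hinfo : ∑ k ∈ Finset.range n, ∑ h ∈ listsOfLength (X × Y) k,
      p₀ h * ∑ x, q h x * ∑ y, P₀ x y * l x y =
      ∑ x, expectedQueries q p₀ n x * ∑ y, P₀ x y * l x y := by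
    simp only [expectedQueries, Finset.sum_mul]
    rw [Finset.sum_comm]
    refine Finset.sum_congr rfl fun k _ => ?_
    rw [Finset.sum_comm]
    exact Finset.sum_congr rfl fun h _ => by
      rw [Finset.mul_sum]
      exact Finset.sum_congr rfl fun x _ => (mul_assoc _ _ _).symm
  rw [← hinfo, ← hp₀.sum_stopped_mul_sum_add hP₀ l n]
  have e0 := hp₀.sum_stopped_add hP₀ n
  have e1 := hp₁.sum_stopped_add hP₁ n
  have k1 := Finset.sum_le_sum fun k (_ : k ∈ Finset.range n) =>
    Finset.sum_le_sum fun h (_ : h ∈ listsOfLength (X × Y) k) => key h _ (hd h)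
  -- Transcripts of length `n` count with full weight, whether or not the algorithm stops there.
  -- Hence decisions made after exactly `n` queries are covered, and the ranges in the statement end
  -- at `n`.
  have k2 := Finset.sum_le_sum fun h (_ : h ∈ listsOfLength (X × Y) n) => key h 1 (hd1 h)
  simp only [Finset.sum_add_distrib, Finset.sum_sub_distrib, ← Finset.mul_sum, mul_one] at k1 k2
  rw [Finset.sum_range_succ, Finset.sum_range_succ]
  linarith

end IsTranscriptLaw

end Information

/-! ### Learning algorithms as transcript laws -/

namespace LearningAlgorithm

variable {S A : ℕ} (alg : LearningAlgorithm S A) (M : SSP S A)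

instance (h : List (Sample S A)) : MeasureTheory.IsProbabilityMeasure (alg.decideOn M h) :=
  alg.isProb _ _ _

theorem transcriptProb_nil : alg.transcriptProb M [] = 1 := by
  simp [transcriptProb]

theorem transcriptProb_append (h : List (Sample S A)) (z : Sample S A) :
    alg.transcriptProb M (h ++ [z]) = alg.transcriptProb M h *
      (alg.decideOn M h {Sum.inl z.1} * M.trans z.1.1 z.1.2 z.2) := by
  have hlen : h.length + 1 = (h ++ [z]).length := by simp
  unfold transcriptProb
  rw [← Equiv.prod_comp (finCongr hlen), Fin.prod_univ_castSucc]
  congr 1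
  · refine Finset.prod_congr rfl fun i _ => ?_
    have h1 : (h ++ [z]).get (finCongr hlen i.castSucc) = h.get i := by
      simp [List.getElem_append_left]
    have h2 : (h ++ [z]).take (finCongr hlen i.castSucc) = h.take i := by
      simp [List.take_append_of_le_length i.2.le]
    rw [h1, h2]
  · have h1 : (h ++ [z]).get (finCongr hlen (Fin.last _)) = z := by simp
    have h2 : (h ++ [z]).take (finCongr hlen (Fin.last _)) = h := by simp
    rw [h1, h2]

/-- The probability of each query after a given transcript. -/
noncomputable def queryProb (h : List (Sample S A)) (x : Fin S × Fin A) : ℝ :=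
  (alg.decideOn M h {Sum.inl x}).toReal

theorem isTranscriptLaw : IsTranscriptLaw (alg.queryProb M)
    (fun x y => (M.trans x.1 x.2 y).toReal) (fun h => (alg.transcriptProb M h).toReal) where
  nil := by simp [transcriptProb_nil]
  append h z := by simp [transcriptProb_append, queryProb, ENNReal.toReal_mul]

theorem sum_trans_toReal (x : Fin S × Fin A) :
    ∑ y, (M.trans x.1 x.2 y).toReal = 1 := by
  rw [← ENNReal.toReal_sum fun y _ => (M.trans x.1 x.2).apply_ne_top y, ← tsum_fintype (L := .unconditional _),
    (M.trans x.1 x.2).tsum_coe, ENNReal.toReal_one]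

theorem transcriptProb_ne_top (h : List (Sample S A)) : alg.transcriptProb M h ≠ ⊤ :=
  ENNReal.prod_ne_top fun _ _ =>
    ENNReal.mul_ne_top (MeasureTheory.measure_ne_top _ _) (PMF.apply_ne_top _ _)

theorem sum_queryProb_add (h : List (Sample S A)) :
    ∑ x, alg.queryProb M h x + (alg.decideOn M h (Set.range Sum.inr)).toReal = 1 := by
  have h1 : ∑ x, alg.queryProb M h x = (alg.decideOn M h (Set.range Sum.inl)).toReal := by
    unfold queryProb
    rw [← ENNReal.toReal_sum fun _ _ => MeasureTheory.measure_ne_top _ _]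
    congr 1
    rw [← tsum_fintype (L := .unconditional _), ← MeasureTheory.measure_iUnion]
    · congr 1
      ext; simp [eq_comm]
    · intro x y hxy
      simpa [Function.onFun] using hxy
    · intro x
      rw [← Set.image_singleton]
      exact (MeasurableSet.singleton x).inl_image
  rw [h1, ← ENNReal.toReal_add (MeasureTheory.measure_ne_top _ _)
    (MeasureTheory.measure_ne_top _ _), ← MeasureTheory.measure_union
    (Set.isCompl_range_inl_range_inr.disjoint) measurableSet_range_inr,
    Set.range_inl_union_range_inr, MeasureTheory.measure_univ, ENNReal.toReal_one]

theorem toReal_decideOn_le (h : List (Sample S A)) (G : Set (SSPPolicy S A)) :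
    (alg.decideOn M h (Sum.inr '' G)).toReal ≤ 1 - ∑ x, alg.queryProb M h x := by
  rw [← alg.sum_queryProb_add M h, add_sub_cancel_left]
  exact ENNReal.toReal_mono (MeasureTheory.measure_ne_top _ _)
    (MeasureTheory.measure_mono (Set.image_subset_range _ _))

theorem outputProb_natCast (N : ℕ) (G : Set (SSPPolicy S A)) :
    alg.outputProb M N G = ∑ k ∈ Finset.range (N + 1), ∑ h ∈ listsOfLength (Sample S A) k,
      alg.transcriptProb M h * alg.decideOn M h (Sum.inr '' G) := by
  rw [← Finset.sum_biUnion]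
  · rw [← Finset.tsum_subtype]
    refine (Equiv.subtypeEquivRight fun h => ?_).tsum_eq
      (fun h : {h // h ∈ (Finset.range (N + 1)).biUnion (listsOfLength (Sample S A))} =>
        alg.transcriptProb M h * alg.decideOn M h (Sum.inr '' G))
    simp [mem_listsOfLength]
  · intro i _ j _ hij
    refine Finset.disjoint_left.2 fun h hi hj => hij ?_
    rw [← mem_listsOfLength.1 hi, ← mem_listsOfLength.1 hj]

theorem outputProb_natCast_ne_top (N : ℕ) (G : Set (SSPPolicy S A)) :
    alg.outputProb M N G ≠ ⊤ := by
  rw [outputProb_natCast]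
  exact ENNReal.sum_ne_top.2 fun _ _ => ENNReal.sum_ne_top.2 fun _ _ =>
    ENNReal.mul_ne_top (transcriptProb_ne_top _ _ _) (MeasureTheory.measure_ne_top _ _)

theorem toReal_outputProb (N : ℕ) (G : Set (SSPPolicy S A)) :
    (alg.outputProb M N G).toReal =
      ∑ k ∈ Finset.range (N + 1), ∑ h ∈ listsOfLength (Sample S A) k,
        (alg.transcriptProb M h).toReal * (alg.decideOn M h (Sum.inr '' G)).toReal := by
  have hne : ∀ h, alg.transcriptProb M h * alg.decideOn M h (Sum.inr '' G) ≠ ⊤ := fun h =>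
    ENNReal.mul_ne_top (transcriptProb_ne_top _ _ _) (MeasureTheory.measure_ne_top _ _)
  rw [outputProb_natCast, ENNReal.toReal_sum fun _ _ => ENNReal.sum_ne_top.2 fun _ _ => hne _]
  refine Finset.sum_congr rfl fun k _ => ?_
  rw [ENNReal.toReal_sum fun _ _ => hne _]
  simp only [ENNReal.toReal_mul]

theorem outputProb_le_one (n : ℕ∞) (G : Set (SSPPolicy S A)) : alg.outputProb M n G ≤ 1 := by
  have hnat : ∀ N : ℕ, alg.outputProb M N G ≤ 1 := fun N => by
    rw [← ENNReal.toReal_le_toReal (alg.outputProb_natCast_ne_top M N G) ENNReal.one_ne_top,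
      ENNReal.toReal_one, toReal_outputProb,
      ← (alg.isTranscriptLaw M).sum_stopped_add (sum_trans_toReal M) (N + 1)]
    refine le_add_of_le_of_nonneg (Finset.sum_le_sum fun k _ => Finset.sum_le_sum fun h _ => ?_)
      (Finset.sum_nonneg fun _ _ => ENNReal.toReal_nonneg)
    exact mul_le_mul_of_nonneg_left (alg.toReal_decideOn_le M h G) ENNReal.toReal_nonneg
  refine ENNReal.summable.tsum_le_of_sum_le fun s => ?_
  -- Finitely many transcripts have bounded length, which reduces the claim to a finite budget.
  refine le_trans ?_ (hnat (s.sup fun h => h.1.length))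
  rw [outputProb_natCast, ← Finset.sum_biUnion]
  · refine (Finset.sum_map s ⟨Subtype.val, Subtype.val_injective⟩
      (fun h => alg.transcriptProb M h * alg.decideOn M h (Sum.inr '' G))).symm.trans_le ?_
    refine Finset.sum_le_sum_of_subset fun h hh => ?_
    obtain ⟨h', hh', rfl⟩ := Finset.mem_map.1 hh
    refine Finset.mem_biUnion.2 ⟨h'.1.length, ?_, mem_listsOfLength.2 rfl⟩
    exact Finset.mem_range.2 (Nat.lt_succ_of_le
      (Finset.le_sup (f := fun h : {h : List (Sample S A) // (h.length : ℕ∞) ≤ n} =>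
        h.1.length) hh'))
  · intro i _ j _ hij
    refine Finset.disjoint_left.2 fun h hi hj => hij ?_
    rw [← mem_listsOfLength.1 hi, ← mem_listsOfLength.1 hj]

theorem outputProb_mono {n m : ℕ∞} (hnm : n ≤ m) (G : Set (SSPPolicy S A)) :
    alg.outputProb M n G ≤ alg.outputProb M m G :=
  ENNReal.tsum_mono_subtype
    (fun h => alg.transcriptProb M h * alg.decideOn M h (Sum.inr '' G))
    (s := {h | (h.length : ℕ∞) ≤ n}) (t := {h | (h.length : ℕ∞) ≤ m})
    fun _ hh => le_trans hh hnm

/-- Different budgets do no harm: both are enlarged to `⊤`, after which each decision law is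
additive on the two disjoint sets. -/
theorem outputProb_add_le_one (n m : ℕ∞) {G G' : Set (SSPPolicy S A)} (hG' : MeasurableSet G')
    (hdisj : Disjoint G G') : alg.outputProb M n G + alg.outputProb M m G' ≤ 1 := by
  refine (add_le_add (alg.outputProb_mono M le_top G) (alg.outputProb_mono M le_top G')).trans ?_
  refine le_trans (le_of_eq ?_) (alg.outputProb_le_one M ⊤ (G ∪ G'))
  unfold outputProb
  rw [← ENNReal.tsum_add]
  refine tsum_congr fun h => ?_
  rw [Set.image_union, MeasureTheory.measure_union (hdisj.image Sum.inr_injective.injOn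
    (Set.subset_univ _) (Set.subset_univ _)) hG'.inr_image, mul_add]

/-- An algorithm that is correct on two instances whose sets of good outputs are disjoint has to
collect information in expectation. -/
theorem log_le_sum_expectedQueries {M₀ M₁ : SSP S A} (hinit : M₁.init = M₀.init)
    (hcost : M₁.cost = M₀.cost) {δ : ℝ} (hδ : 0 < δ) (hδ' : δ < 1 / (2 * Real.exp 4))
    {N : ℕ} {n : ℕ∞} {G₀ G₁ : Set (SSPPolicy S A)} (hG₁ : MeasurableSet G₁)
    (hdisj : Disjoint G₀ G₁)
    (h₀ : ENNReal.ofReal (1 - δ) ≤ alg.outputProb M₀ N G₀)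
    (h₁ : ENNReal.ofReal (1 - δ) ≤ alg.outputProb M₁ n G₁)
    {l : Fin S × Fin A → Option (Fin S) → ℝ}
    (hl : ∀ x y, (M₁.trans x.1 x.2 y).toReal = (M₀.trans x.1 x.2 y).toReal * Real.exp (-l x y)) :
    Real.log (1 / δ) / 2 ≤
      ∑ x, IsTranscriptLaw.expectedQueries (alg.queryProb M₀)
        (fun h => (alg.transcriptProb M₀ h).toReal) N x *
          ∑ y, (M₀.trans x.1 x.2 y).toReal * l x y := by
  have hdec : ∀ h, alg.decideOn M₁ h = alg.decideOn M₀ h := fun h => by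
    unfold decideOn; rw [hinit, hcost]
  have hlaw₁ : IsTranscriptLaw (alg.queryProb M₀) (fun x y => (M₁.trans x.1 x.2 y).toReal)
      (fun h => (alg.transcriptProb M₁ h).toReal) := by
    have := alg.isTranscriptLaw M₁
    have hq : alg.queryProb M₁ = alg.queryProb M₀ := by
      funext h x; unfold queryProb; rw [hdec]
    rwa [hq] at this
  have h4 : (1 : ℝ) ≤ Real.exp 4 := Real.one_le_exp (by norm_num)
  have hδ1 : δ < 1 / 2 := hδ'.trans_le (by
    rw [div_le_div_iff₀ (by positivity) (by norm_num)]; linarith)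
  have hlog : 4 ≤ Real.log (1 / δ) := by
    rw [Real.le_log_iff_exp_le (by positivity), le_div_iff₀ hδ]
    rw [lt_div_iff₀ (by positivity)] at hδ'
    nlinarith
  have hkey := (alg.isTranscriptLaw M₀).log_mul_sub_le hlaw₁ (sum_trans_toReal M₀)
    (sum_trans_toReal M₁) (fun _ _ => ENNReal.toReal_nonneg) (fun _ _ => ENNReal.toReal_nonneg) hl
    (d := fun h => (alg.decideOn M₀ h (Sum.inr '' G₀)).toReal) (fun _ => ENNReal.toReal_nonneg)
    (fun h => alg.toReal_decideOn_le M₀ h G₀) N (c := 1 / δ) (by positivity)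
  rw [← alg.toReal_outputProb M₀ N G₀] at hkey
  have hE₁ := alg.toReal_outputProb M₁ N G₀
  simp only [hdec] at hE₁
  rw [← hE₁] at hkey
  have hb₀ : 1 - δ ≤ (alg.outputProb M₀ N G₀).toReal :=
    (ENNReal.ofReal_le_iff_le_toReal (alg.outputProb_natCast_ne_top M₀ N G₀)).1 h₀
  -- On `M₁` the outputs in `G₁` already take mass `1 - δ`, leaving at most `δ` for `G₀`.
  have hb₁ : (alg.outputProb M₁ N G₀).toReal ≤ δ := by
    have h := (add_le_add_right h₁ _).trans
      (alg.outputProb_add_le_one M₁ (N : ℕ∞) n hG₁ hdisj)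
    have h' := ENNReal.toReal_mono ENNReal.one_ne_top h
    rw [ENNReal.toReal_add (alg.outputProb_natCast_ne_top M₁ N G₀) ENNReal.ofReal_ne_top,
      ENNReal.toReal_ofReal (by linarith), ENNReal.toReal_one] at h'
    linarith
  refine le_trans ?_ hkey
  have e1 := mul_le_mul_of_nonneg_left hb₀ (by linarith : 0 ≤ Real.log (1 / δ))
  have hc : 1 ≤ 1 / δ := by rw [le_div_iff₀ hδ]; linarith
  have e2 := mul_le_mul_of_nonneg_left hb₁ (by linarith : 0 ≤ 1 / δ - 1)
  have e3 : (1 / δ - 1) * δ = 1 - δ := by field_simp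
  have hδ2 : δ ≤ 1 / 4 := hδ'.le.trans (by
    have : (2 : ℝ) ≤ Real.exp 4 := by linarith [Real.add_one_le_exp (4 : ℝ)]
    rw [div_le_div_iff₀ (by positivity) (by norm_num)]; linarith)
  -- It remains to see that `(1 - δ) * (log (1/δ) - 1) ≥ log (1/δ) / 2`, which holds since `log
  -- (1/δ) ≥ 4` and `δ ≤ 1/4`.
  nlinarith

end LearningAlgorithm

/-! ### The `A`-ary heap -/

/-- The depth of the node `n` of the infinite heap in which the children of the node `i` are
`A * i + 1, …, A * i + A`. -/
def heapDepth (A : ℕ) : ℕ → ℕ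
  | 0 => 0
  | n + 1 => heapDepth A (n / A) + 1
decreasing_by exact Nat.lt_succ_of_le (Nat.div_le_self _ _)

theorem heapDepth_zero (A : ℕ) : heapDepth A 0 = 0 := by rw [heapDepth]

theorem heapDepth_succ (A n : ℕ) : heapDepth A (n + 1) = heapDepth A (n / A) + 1 := by
  rw [heapDepth]

theorem heapDepth_child {A a : ℕ} (ha : a < A) (i : ℕ) :
    heapDepth A (A * i + a + 1) = heapDepth A i + 1 := by
  rw [heapDepth_succ, Nat.mul_add_div (by omega), Nat.div_eq_of_lt ha, add_zero]

theorem heapDepth_mono (A : ℕ) {i j : ℕ} (hij : i ≤ j) : heapDepth A i ≤ heapDepth A j := by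
  induction j using Nat.strong_induction_on generalizing i with
  | _ j ih =>
    cases i with
    | zero => rw [heapDepth_zero]; exact Nat.zero_le _
    | succ i =>
      obtain ⟨j, rfl⟩ : ∃ k, j = k + 1 := ⟨j - 1, by omega⟩
      rw [heapDepth_succ, heapDepth_succ]
      exact Nat.succ_le_succ (ih _ (Nat.lt_succ_of_le (Nat.div_le_self _ _))
        (Nat.div_le_div_right (by omega)))

/-- For `A ≥ 2` the first node at depth `d` has index `(A ^ d - 1) / (A - 1)`, where equality holds.
-/
theorem pow_heapDepth_le {A : ℕ} (hA : 1 ≤ A) (n : ℕ) :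
    A ^ heapDepth A n ≤ n * (A - 1) + 1 := by
  induction n using Nat.strong_induction_on with
  | _ n ih =>
    cases n with
    | zero => simp [heapDepth_zero]
    | succ n =>
      rw [heapDepth_succ, pow_succ]
      have h1 := ih (n / A) (Nat.lt_succ_of_le (Nat.div_le_self _ _))
      have h2 := Nat.div_mul_le_self n A
      obtain ⟨b, rfl⟩ : ∃ b, A = b + 1 := ⟨A - 1, by omega⟩
      simp only [Nat.add_sub_cancel] at h1 ⊢
      nlinarith [Nat.mul_le_mul_right (b + 1) h1, Nat.mul_le_mul_right b h2]

/-- The ancestors of a node of the heap, including the node itself. -/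
inductive IsHeapAncestor (A n : ℕ) : ℕ → Prop
  | self : IsHeapAncestor A n n
  | parent {c : ℕ} : IsHeapAncestor A n c → c ≠ 0 → IsHeapAncestor A n ((c - 1) / A)

namespace IsHeapAncestor

variable {A n i : ℕ}

theorem le (h : IsHeapAncestor A n i) : i ≤ n := by
  induction h with
  | self => exact le_rfl
  | parent _ _ ih => exact (Nat.div_le_self _ _).trans ((Nat.sub_le _ _).trans ih)

theorem zero (h : IsHeapAncestor A n i) : IsHeapAncestor A n 0 := by
  induction i using Nat.strong_induction_on with
  | _ i ih =>
    rcases eq_or_ne i 0 with rfl | hi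
    · exact h
    · exact ih _ ((Nat.div_le_self _ _).trans_lt (by omega)) (h.parent hi)

theorem exists_child (hA : 1 ≤ A) (h : IsHeapAncestor A n i) (hne : i ≠ n) :
    ∃ a < A, IsHeapAncestor A n (A * i + a + 1) := by
  cases h with
  | self => exact absurd rfl hne
  | @parent c hc hc0 =>
    refine ⟨(c - 1) % A, Nat.mod_lt _ hA, ?_⟩
    rwa [Nat.div_add_mod, Nat.sub_add_cancel (by omega)]

end IsHeapAncestor

/-- Parameters of a family of hard instances. -/
structure HardParams (S A : ℕ) where
  cmin : ℝ
  B : ℝ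
  T : ℝ
  K : ℝ
  ε : ℝ
  two_le_S : 2 ≤ S
  three_le_A : 3 ≤ A
  cmin_nonneg : 0 ≤ cmin
  two_le_B : 2 ≤ B
  B_le_T : B ≤ T
  log_le_T : Real.logb A S + 1 ≤ T
  cmin_mul_T_le : cmin * T ≤ B
  T_le_K : T ≤ K
  cmin_mul_K_le : cmin * K ≤ B
  ε_pos : 0 < ε
  ε_lt : ε < 1 / 32

/-! ### The hard instances and their hitting times -/

namespace HardParams

variable {S A : ℕ} (p : HardParams S A)

/-- The state reached after a failure. -/
def sink : Fin S := ⟨S - 1, by have := p.two_le_S; omega⟩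

/-- The root of the heap. -/
def root : Fin S := ⟨0, by have := p.two_le_S; omega⟩

/-- The action that leaves a leaf of the heap in one step. -/
def fast : Fin A := ⟨0, by have := p.three_le_A; omega⟩

/-- The expected time that the other actions need to leave a leaf. -/
noncomputable def T₁ : ℝ := 1 + p.K / 8

/-- The depth of the heap that consists of all states but the sink. -/
def D (_ : HardParams S A) : ℕ := heapDepth A (S - 2)

/-- The distance of a node to the deepest level of the heap. -/
def lack (_ : HardParams S A) (s : Fin S) : ℝ := heapDepth A (S - 2) - heapDepth A s

/-- The nodes of the heap that have a child. -/
def Inner (_ : HardParams S A) (s : Fin S) : Prop := A * s + 1 < S - 1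

/-- The leaves of the heap. -/
def Leaf (_ : HardParams S A) (s : Fin S) : Prop := s < S - 1 ∧ S - 1 ≤ A * s + 1

instance : DecidablePred p.Inner := fun s => inferInstanceAs (Decidable (A * s + 1 < S - 1))

instance : DecidablePred p.Leaf := fun s =>
  inferInstanceAs (Decidable (s < S - 1 ∧ S - 1 ≤ A * s + 1))

/-- The probability that a slow action fails. -/
noncomputable def slowProb (s : Fin S) : ℝ := 1 / 4 + p.lack s * p.cmin / p.B

/-- The probability that the fast action fails. -/
noncomputable def fastProb (s : Fin S) : ℝ :=
  p.slowProb s + (p.cmin * (p.T₁ - 1) - 3 * p.ε) / p.B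

/-- The node that an action leads to; leaves and the sink lead to themselves. -/
def tgt (_ : HardParams S A) (s : Fin S) (a : Fin A) : Fin S :=
  if h : A * s + a + 1 < S - 1 then ⟨A * s + a + 1, by omega⟩
  else if h : A * s + 1 < S - 1 then ⟨A * s + 1, by omega⟩ else s

/-- With exit probability `1 / T` the sink has value `B` and hitting time `T`; it witnesses the
lower bounds on `Bstar` and `Tstar`. -/
noncomputable def cost (s : Fin S) (_ : Fin A) : ℝ := if s = p.sink then p.B / p.T else p.cmin

/-- The probability of the transition to `tgt s a`. -/
noncomputable def moveProb (s : Fin S) (a : Fin A) : ℝ :=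
  if s = p.sink then 1 - 1 / p.T else if p.Inner s then 1
  else if a = p.fast then 0 else 1 - 1 / p.T₁

/-- The probability of an additional transition to the sink, where `g` says by how much the
slow actions are perturbed. -/
noncomputable def sinkProb (g : Fin S → Fin A → unitInterval) (s : Fin S) (a : Fin A) : ℝ :=
  if s = p.sink then 0 else if p.Inner s then 0
  else if a = p.fast then p.fastProb s else (p.slowProb s - 6 * p.ε / p.B * g s a) / p.T₁

theorem two_le_T : 2 ≤ p.T := p.two_le_B.trans p.B_le_T

theorem B_pos : 0 < p.B := by linarith [p.two_le_B]

theorem T_pos : 0 < p.T := by linarith [p.two_le_T]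

theorem one_lt_T₁ : 1 < p.T₁ := by
  unfold T₁; linarith [p.T_le_K, p.T_pos]

theorem T₁_pos : 0 < p.T₁ := one_pos.trans p.one_lt_T₁

theorem D_le_T : (p.D : ℝ) ≤ p.T := by
  refine le_trans ?_ p.log_le_T
  have hA : (1 : ℝ) < A := by exact_mod_cast lt_of_lt_of_le (by norm_num) p.three_le_A
  have hS : (0 : ℝ) < S := by exact_mod_cast lt_of_lt_of_le (by norm_num) p.two_le_S
  have h1 : A ^ p.D ≤ S * A := by
    refine (pow_heapDepth_le (by linarith [p.three_le_A]) (S - 2)).trans ?_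
    have h2 : (S - 2) * (A - 1) ≤ (S - 2) * A := Nat.mul_le_mul_left _ (Nat.sub_le _ _)
    have h3 : S * A = (S - 2) * A + 2 * A := by
      rw [← Nat.add_mul, Nat.sub_add_cancel p.two_le_S]
    have := p.three_le_A
    omega
  have h2 : ((A : ℝ) ^ (p.D : ℝ)) ≤ S * A := by
    rw [Real.rpow_natCast]; exact_mod_cast h1
  have h3 := (Real.le_logb_iff_rpow_le hA (by positivity)).2 h2
  rwa [Real.logb_mul hS.ne' (by linarith), Real.logb_self_eq_one hA] at h3

theorem D_add_one_le : (p.D : ℝ) + 1 ≤ 3 / 2 * p.T := by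
  rcases Nat.lt_or_ge p.D 2 with h | h
  · have : (p.D : ℝ) ≤ 1 := by exact_mod_cast Nat.le_of_lt_succ h
    linarith [p.two_le_T]
  · have : (2 : ℝ) ≤ p.D := by exact_mod_cast h
    linarith [p.D_le_T]

theorem ne_sink_iff {s : Fin S} : s ≠ p.sink ↔ (s : ℕ) < S - 1 := by
  rw [ne_eq, Fin.ext_iff]
  change ¬ (s : ℕ) = S - 1 ↔ _
  have := s.2
  omega

theorem Inner.ne_sink {p : HardParams S A} {s : Fin S} (hs : p.Inner s) : s ≠ p.sink := by
  rw [ne_sink_iff]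
  unfold Inner at hs
  have := Nat.le_mul_of_pos_left (s : ℕ) (lt_of_lt_of_le (by norm_num) p.three_le_A : 0 < A)
  omega

theorem Leaf.ne_sink {p : HardParams S A} {s : Fin S} (hs : p.Leaf s) : s ≠ p.sink :=
  p.ne_sink_iff.2 hs.1

theorem Leaf.not_inner {p : HardParams S A} {s : Fin S} (hs : p.Leaf s) : ¬ p.Inner s :=
  not_lt.2 hs.2

theorem trichotomy (s : Fin S) : s = p.sink ∨ p.Inner s ∨ p.Leaf s := by
  by_cases h : s = p.sink
  · exact Or.inl h
  · have := p.ne_sink_iff.1 h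
    unfold Inner Leaf
    omega

theorem root_ne_sink : p.root ≠ p.sink := p.ne_sink_iff.2 (by
  change 0 < S - 1
  have := p.two_le_S; omega)

theorem lack_nonneg {s : Fin S} (hs : s ≠ p.sink) : 0 ≤ p.lack s := by
  rw [ne_sink_iff] at hs
  exact sub_nonneg.2 (by exact_mod_cast heapDepth_mono A (by omega))

theorem lack_le (s : Fin S) : p.lack s ≤ p.D := by
  unfold lack D
  linarith [(Nat.cast_nonneg (heapDepth A s) : (0 : ℝ) ≤ _)]

/-- The parent of the last node `S - 2` has an index no larger than that of any leaf, so the leaves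
occupy the two deepest levels. This keeps `slowProb` away from `1`. -/
theorem Leaf.lack_le_one {p : HardParams S A} {s : Fin S} (hs : p.Leaf s) : p.lack s ≤ 1 := by
  have h : heapDepth A (S - 2) ≤ heapDepth A s + 1 := by
    rcases Nat.eq_zero_or_pos (S - 2) with h0 | h0
    · rw [h0, heapDepth_zero]; exact Nat.zero_le _
    · obtain ⟨k, hk⟩ : ∃ k, S - 2 = k + 1 := ⟨S - 2 - 1, by omega⟩
      rw [hk, heapDepth_succ]
      refine Nat.succ_le_succ (heapDepth_mono A ?_)
      have h2 := hs.2
      have h3 : A * (s : ℕ) = s * A := mul_comm _ _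
      exact Nat.div_le_of_le_mul (by omega)
  unfold lack
  have : (heapDepth A (S - 2) : ℝ) ≤ heapDepth A s + 1 := by exact_mod_cast h
  linarith

theorem tgt_of_not_inner {s : Fin S} (hs : ¬ p.Inner s) (a : Fin A) : p.tgt s a = s := by
  unfold Inner at hs
  rw [tgt, dif_neg (by omega), dif_neg hs]

theorem Inner.lack_tgt {p : HardParams S A} {s : Fin S} (hs : p.Inner s) (a : Fin A) :
    p.lack (p.tgt s a) = p.lack s - 1 := by
  have : heapDepth A (p.tgt s a) = heapDepth A s + 1 := by
    unfold tgt
    split_ifs with h h'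
    · exact heapDepth_child a.2 s
    · exact heapDepth_child (a := 0) (lt_of_lt_of_le (by norm_num) p.three_le_A) s
    · exact absurd hs h'
  unfold lack
  rw [this]
  push_cast
  ring

theorem Inner.tgt_ne_sink {p : HardParams S A} {s : Fin S} (hs : p.Inner s) (a : Fin A) :
    p.tgt s a ≠ p.sink := by
  rw [ne_sink_iff]
  unfold tgt
  split_ifs with h h'
  · exact h
  · exact h'
  · exact absurd hs h'

theorem cmin_le : p.cmin / p.B ≤ 1 / 2 := by
  rw [div_le_div_iff₀ p.B_pos (by norm_num)]
  nlinarith [p.cmin_mul_T_le, p.two_le_T, p.cmin_nonneg]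

/-- The divisor `8` in `T₁` keeps the extra waiting cost small enough for `fastProb` to be a
probability. -/
theorem cmin_mul_T₁ : p.cmin * (p.T₁ - 1) ≤ p.B / 8 := by
  unfold T₁; linarith [p.cmin_mul_K_le]

theorem cmin_mul_T₁_nonneg : 0 ≤ p.cmin * (p.T₁ - 1) :=
  mul_nonneg p.cmin_nonneg (by linarith [p.one_lt_T₁])

theorem gap_le : 6 * p.ε / p.B ≤ 3 / 32 := by
  rw [div_le_div_iff₀ p.B_pos (by norm_num)]
  linarith [p.two_le_B, p.ε_lt]

theorem gap_pos : 0 < 6 * p.ε / p.B := div_pos (by linarith [p.ε_pos]) p.B_pos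

theorem quarter_le_slowProb {s : Fin S} (hs : s ≠ p.sink) : 1 / 4 ≤ p.slowProb s :=
  le_add_of_nonneg_right
    (div_nonneg (mul_nonneg (p.lack_nonneg hs) p.cmin_nonneg) p.B_pos.le)

theorem Leaf.slowProb_le {p : HardParams S A} {s : Fin S} (hs : p.Leaf s) :
    p.slowProb s ≤ 3 / 4 := by
  have h1 := mul_le_mul_of_nonneg_right hs.lack_le_one (div_nonneg p.cmin_nonneg p.B_pos.le)
  unfold slowProb
  rw [mul_div_assoc]
  linarith [p.cmin_le]

theorem fastProb_nonneg {s : Fin S} (hs : s ≠ p.sink) : 0 ≤ p.fastProb s := by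
  have h2 := div_nonneg p.cmin_mul_T₁_nonneg p.B_pos.le
  have h3 : 3 * p.ε / p.B = 6 * p.ε / p.B / 2 := by ring
  unfold fastProb
  rw [sub_div]
  linarith [p.quarter_le_slowProb hs, p.gap_le]

theorem Leaf.fastProb_le {p : HardParams S A} {s : Fin S} (hs : p.Leaf s) :
    p.fastProb s ≤ 1 := by
  have h1 : p.cmin * (p.T₁ - 1) / p.B ≤ 1 / 8 := by
    rw [div_le_div_iff₀ p.B_pos (by norm_num)]
    linarith [p.cmin_mul_T₁]
  have h3 : 3 * p.ε / p.B = 6 * p.ε / p.B / 2 := by ring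
  unfold fastProb
  rw [sub_div]
  linarith [hs.slowProb_le, p.gap_pos]

theorem gap_mul_le (x : unitInterval) : 6 * p.ε / p.B * x ≤ 3 / 32 :=
  (mul_le_of_le_one_right p.gap_pos.le x.2.2).trans p.gap_le

theorem gap_mul_nonneg (x : unitInterval) : 0 ≤ 6 * p.ε / p.B * x :=
  mul_nonneg p.gap_pos.le x.2.1

theorem moveProb_nonneg (s : Fin S) (a : Fin A) : 0 ≤ p.moveProb s a := by
  unfold moveProb
  have h1 : 1 / p.T ≤ 1 := by rw [div_le_one p.T_pos]; linarith [p.two_le_T]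
  have h2 : 1 / p.T₁ ≤ 1 := by rw [div_le_one p.T₁_pos]; exact p.one_lt_T₁.le
  split_ifs <;> linarith

theorem sinkProb_nonneg (g : Fin S → Fin A → unitInterval) (s : Fin S) (a : Fin A) :
    0 ≤ p.sinkProb g s a := by
  unfold sinkProb
  split_ifs with h1 h2 h3
  · exact le_rfl
  · exact le_rfl
  · exact p.fastProb_nonneg h1
  · exact div_nonneg (by linarith [p.quarter_le_slowProb h1, p.gap_mul_le (g s a)]) p.T₁_pos.le

theorem moveProb_add_sinkProb_le (g : Fin S → Fin A → unitInterval) (s : Fin S) (a : Fin A) :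
    p.moveProb s a + p.sinkProb g s a ≤ 1 := by
  have hT : 0 ≤ 1 / p.T := (div_pos one_pos p.T_pos).le
  unfold moveProb sinkProb
  split_ifs with h1 h2 h3
  · linarith
  · linarith
  · have : p.Leaf s := by have := p.trichotomy s; tauto
    linarith [this.fastProb_le]
  · have : p.Leaf s := by have := p.trichotomy s; tauto
    have h4 := this.slowProb_le
    have h5 : (p.slowProb s - 6 * p.ε / p.B * g s a) / p.T₁ ≤ 1 / p.T₁ :=
      div_le_div_of_nonneg_right (by linarith [p.gap_mul_nonneg (g s a)]) p.T₁_pos.le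
    linarith

/-- The transition probabilities of the hard instance. -/
noncomputable def weight (g : Fin S → Fin A → unitInterval) (s : Fin S) (a : Fin A)
    (y : Option (Fin S)) : ℝ :=
  (if y = some (p.tgt s a) then p.moveProb s a else 0) +
    (if y = some p.sink then p.sinkProb g s a else 0) +
    (if y = none then 1 - p.moveProb s a - p.sinkProb g s a else 0)

theorem weight_nonneg (g : Fin S → Fin A → unitInterval) (s : Fin S) (a : Fin A)
    (y : Option (Fin S)) : 0 ≤ p.weight g s a y := by
  have h1 := p.moveProb_nonneg s a
  have h2 := p.sinkProb_nonneg g s a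
  have h3 := p.moveProb_add_sinkProb_le g s a
  unfold weight
  refine add_nonneg (add_nonneg ?_ ?_) ?_ <;> split_ifs <;> linarith

theorem sum_weight (g : Fin S → Fin A → unitInterval) (s : Fin S) (a : Fin A) :
    ∑ y, p.weight g s a y = 1 := by
  simp only [weight, Finset.sum_add_distrib, Finset.sum_ite_eq', Finset.mem_univ, if_true]
  ring

theorem cost_nonneg (s : Fin S) (a : Fin A) : 0 ≤ p.cost s a := by
  unfold cost
  split_ifs
  · exact div_nonneg p.B_pos.le p.T_pos.le
  · exact p.cmin_nonneg

theorem cmin_le_div : p.cmin ≤ p.B / p.T := by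
  rw [le_div_iff₀ p.T_pos]; exact p.cmin_mul_T_le

theorem B_div_T_le_one : p.B / p.T ≤ 1 := by
  rw [div_le_one p.T_pos]; exact p.B_le_T

/-- The hard instance in which the slow actions are perturbed by `g`. -/
noncomputable def inst (g : Fin S → Fin A → unitInterval) : SSP S A where
  init := p.root
  cost := p.cost
  trans s a := PMF.ofFintype (fun y => ENNReal.ofReal (p.weight g s a y)) (by
    rw [← ENNReal.ofReal_sum_of_nonneg fun y _ => p.weight_nonneg g s a y, p.sum_weight,
      ENNReal.ofReal_one])
  cost_nonneg := p.cost_nonneg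
  cost_le_one s a := by
    unfold cost
    split_ifs
    · exact p.B_div_T_le_one
    · exact p.cmin_le_div.trans p.B_div_T_le_one

theorem toReal_trans (g : Fin S → Fin A → unitInterval) (s : Fin S) (a : Fin A)
    (y : Option (Fin S)) : ((p.inst g).trans s a y).toReal = p.weight g s a y :=
  ENNReal.toReal_ofReal (p.weight_nonneg g s a y)

theorem sum_trans_mul (g : Fin S → Fin A → unitInterval) (s : Fin S) (a : Fin A)
    (F : Fin S → ℝ≥0∞) : ∑ s', (p.inst g).trans s a (some s') * F s' =
      ENNReal.ofReal (p.moveProb s a) * F (p.tgt s a) +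
        ENNReal.ofReal (p.sinkProb g s a) * F p.sink := by
  have h : ∀ s', (p.inst g).trans s a (some s') =
      (if s' = p.tgt s a then ENNReal.ofReal (p.moveProb s a) else 0) +
        (if s' = p.sink then ENNReal.ofReal (p.sinkProb g s a) else 0) := fun s' => by
    change ENNReal.ofReal (p.weight g s a (some s')) = _
    simp only [weight, Option.some.injEq, reduceCtorEq, if_false, add_zero]
    rw [ENNReal.ofReal_add]
    · split_ifs <;> simp
    · split_ifs; exacts [p.moveProb_nonneg s a, le_rfl]
    · split_ifs; exacts [p.sinkProb_nonneg g s a, le_rfl]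
  simp only [h, add_mul, Finset.sum_add_distrib, ite_mul, zero_mul, Finset.sum_ite_eq',
    Finset.mem_univ, if_true]

/-- The expected value of `Φ` after one transition. -/
noncomputable def back (g : Fin S → Fin A → unitInterval) (Φ : Fin S → ℝ) (s : Fin S)
    (a : Fin A) : ℝ :=
  p.moveProb s a * Φ (p.tgt s a) + p.sinkProb g s a * Φ p.sink

variable (g : Fin S → Fin A → unitInterval) (Φ : Fin S → ℝ)

theorem back_sink (a : Fin A) : p.back g Φ p.sink a = (1 - 1 / p.T) * Φ p.sink := by
  have h : ¬ p.Inner p.sink := fun h => h.ne_sink rfl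
  simp [back, moveProb, sinkProb, p.tgt_of_not_inner h]

variable {p}

theorem Inner.back {s : Fin S} (hs : p.Inner s) (a : Fin A) :
    p.back g Φ s a = Φ (p.tgt s a) := by
  simp [HardParams.back, moveProb, sinkProb, hs.ne_sink, hs]

theorem Leaf.back_fast {s : Fin S} (hs : p.Leaf s) :
    p.back g Φ s p.fast = p.fastProb s * Φ p.sink := by
  simp [HardParams.back, moveProb, sinkProb, hs.ne_sink, hs.not_inner]

theorem Leaf.back_slow {s : Fin S} (hs : p.Leaf s) {a : Fin A} (ha : a ≠ p.fast) :
    p.back g Φ s a = (1 - 1 / p.T₁) * Φ s +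
      (p.slowProb s - 6 * p.ε / p.B * g s a) / p.T₁ * Φ p.sink := by
  simp [HardParams.back, moveProb, sinkProb, hs.ne_sink, hs.not_inner, ha,
    p.tgt_of_not_inner hs.not_inner]

variable (p)

theorem sum_trans_mul_ofReal {Φ : Fin S → ℝ} (hΦ : ∀ s, 0 ≤ Φ s) (s : Fin S) (a : Fin A) :
    ∑ s', (p.inst g).trans s a (some s') * ENNReal.ofReal (Φ s') =
      ENNReal.ofReal (p.back g Φ s a) := by
  rw [sum_trans_mul, back, ENNReal.ofReal_add
    (mul_nonneg (p.moveProb_nonneg s a) (hΦ _)) (mul_nonneg (p.sinkProb_nonneg g s a) (hΦ _)),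
    ENNReal.ofReal_mul (p.moveProb_nonneg s a), ENNReal.ofReal_mul (p.sinkProb_nonneg g s a)]

theorem back_nonneg {Φ : Fin S → ℝ} (hΦ : ∀ s, 0 ≤ Φ s) (s : Fin S) (a : Fin A) :
    0 ≤ p.back g Φ s a :=
  add_nonneg (mul_nonneg (p.moveProb_nonneg s a) (hΦ _))
    (mul_nonneg (p.sinkProb_nonneg g s a) (hΦ _))

theorem back_mono {Φ Ψ : Fin S → ℝ} (h : ∀ s, Φ s ≤ Ψ s) (s : Fin S) (a : Fin A) :
    p.back g Φ s a ≤ p.back g Ψ s a :=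
  add_le_add (mul_le_mul_of_nonneg_left (h _) (p.moveProb_nonneg s a))
    (mul_le_mul_of_nonneg_left (h _) (p.sinkProb_nonneg g s a))

theorem iSup_expSum_le {r : Fin S → Fin A → ℝ} (hr : ∀ s a, 0 ≤ r s a) {Φ : Fin S → ℝ}
    (hΦ : ∀ s, 0 ≤ Φ s) (π : SSPPolicy S A)
    (h : ∀ t s a, (π t s : Fin A → ℝ) a ≠ 0 → r s a + p.back g Φ s a ≤ Φ s) (s : Fin S) :
    ⨆ n, (p.inst g).expSum (fun s a => ENNReal.ofReal (r s a)) n π s ≤ ENNReal.ofReal (Φ s) := by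
  refine iSup_le fun n => (p.inst g).expSum_le _ (fun s => ENNReal.ofReal (Φ s)) n π s
    fun t s a ha => ?_
  rw [p.sum_trans_mul_ofReal g hΦ, ← ENNReal.ofReal_add (hr s a) (p.back_nonneg g hΦ s a)]
  exact ENNReal.ofReal_le_ofReal (h t s a ha)

/-- A function that takes the value `u` in the sink and is affine in the depth on the heap. -/
noncomputable def pot (u v c : ℝ) (s : Fin S) : ℝ :=
  if s = p.sink then u else v + p.lack s * c

theorem pot_sink (u v c : ℝ) : p.pot u v c p.sink = u := if_pos rfl

theorem pot_of_ne (u v c : ℝ) {s : Fin S} (hs : s ≠ p.sink) :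
    p.pot u v c s = v + p.lack s * c := if_neg hs

theorem pot_nonneg {u v c : ℝ} (hu : 0 ≤ u) (hv : 0 ≤ v) (hc : 0 ≤ c) (s : Fin S) :
    0 ≤ p.pot u v c s := by
  unfold pot
  split_ifs with h
  · exact hu
  · exact add_nonneg hv (mul_nonneg (p.lack_nonneg h) hc)

theorem Inner.back_pot {p : HardParams S A} {s : Fin S} (hs : p.Inner s) (a : Fin A)
    (u v c : ℝ) : p.back g (p.pot u v c) s a = p.pot u v c s - c := by
  rw [hs.back, p.pot_of_ne _ _ _ (hs.tgt_ne_sink a), p.pot_of_ne _ _ _ hs.ne_sink, hs.lack_tgt]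
  ring

theorem slowProb_mul_T_le {s : Fin S} (hs : s ≠ p.sink) :
    p.slowProb s * p.T ≤ p.T / 4 + p.lack s := by
  have h1 : p.cmin * p.T / p.B ≤ 1 := by
    rw [div_le_one p.B_pos]; exact p.cmin_mul_T_le
  have h2 := mul_le_mul_of_nonneg_left h1 (p.lack_nonneg hs)
  have h3 : p.slowProb s * p.T = p.T / 4 + p.lack s * (p.cmin * p.T / p.B) := by
    unfold slowProb; ring
  linarith

theorem cmin_mul_T₁_div_mul_T_le : p.cmin * (p.T₁ - 1) / p.B * p.T ≤ p.T₁ - 1 := by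
  have h : p.cmin * (p.T₁ - 1) / p.B * p.T = p.cmin * p.T / p.B * (p.T₁ - 1) := by ring
  rw [h]
  refine mul_le_of_le_one_left (by linarith [p.one_lt_T₁]) ?_
  rw [div_le_one p.B_pos]; exact p.cmin_mul_T_le

/-- An upper bound on the hitting time of every policy. -/
theorem one_add_back_pot_le (s : Fin S) (a : Fin A) :
    1 + p.back g (p.pot p.T (p.T₁ + p.T / 4) 1) s a ≤ p.pot p.T (p.T₁ + p.T / 4) 1 s := by
  have hT := p.T_pos.ne'
  have hT₁ := p.T₁_pos
  rcases p.trichotomy s with rfl | hs | hs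
  · rw [back_sink, pot_sink]
    field_simp
    linarith
  · rw [hs.back_pot]
    linarith
  · have h1 := p.slowProb_mul_T_le hs.ne_sink
    rw [p.pot_of_ne _ _ _ hs.ne_sink]
    by_cases ha : a = p.fast
    · rw [ha, hs.back_fast, pot_sink]
      have h3 : p.fastProb s * p.T = p.slowProb s * p.T +
          p.cmin * (p.T₁ - 1) / p.B * p.T - 3 * p.ε / p.B * p.T := by unfold fastProb; ring
      have h4 : 0 ≤ 3 * p.ε / p.B * p.T :=
        mul_nonneg (div_nonneg (by linarith [p.ε_pos]) p.B_pos.le) p.T_pos.le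
      linarith [p.cmin_mul_T₁_div_mul_T_le]
    · rw [hs.back_slow g _ ha, pot_sink, p.pot_of_ne _ _ _ hs.ne_sink]
      have h3 : (p.slowProb s - 6 * p.ε / p.B * g s a) / p.T₁ * p.T ≤
          (p.T / 4 + p.lack s) / p.T₁ := by
        rw [div_mul_eq_mul_div]
        refine div_le_div_of_nonneg_right ?_ hT₁.le
        nlinarith [mul_nonneg (p.gap_mul_nonneg (g s a)) p.T_pos.le]
      have h4 : 1 + ((1 - 1 / p.T₁) * (p.T₁ + p.T / 4 + p.lack s * 1) +
          (p.T / 4 + p.lack s) / p.T₁) = p.T₁ + p.T / 4 + p.lack s * 1 := by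
        field_simp
        ring
      linarith

theorem pot_hitting_nonneg (s : Fin S) : 0 ≤ p.pot p.T (p.T₁ + p.T / 4) 1 s :=
  p.pot_nonneg p.T_pos.le (by linarith [p.T_pos, p.T₁_pos]) zero_le_one s

theorem pot_hitting_le (s : Fin S) :
    p.pot p.T (p.T₁ + p.T / 4) 1 s ≤ 7 / 4 * p.T + p.K / 8 := by
  unfold pot
  split_ifs
  · linarith [p.T_pos, p.T_le_K]
  · have := p.lack_le s
    have := p.D_add_one_le
    unfold T₁
    linarith

theorem hittingTime_le (π : SSPPolicy S A) (s : Fin S) : (p.inst g).hittingTime π s ≤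
    ENNReal.ofReal (p.pot p.T (p.T₁ + p.T / 4) 1 s) := by
  have h := p.iSup_expSum_le g (r := fun _ _ => 1) (fun _ _ => zero_le_one) p.pot_hitting_nonneg π
    (fun _ s a _ => p.one_add_back_pot_le g s a) s
  simp only [ENNReal.ofReal_one] at h
  exact h

theorem proper (π : DecisionRule S A) : (p.inst g).Proper π := fun s =>
  (p.hittingTime_le g _ s).trans_lt ENNReal.ofReal_lt_top

/-- The hitting-time bound `H` satisfies `1 + P H ≤ H ≤ m` for every action, hence `P H ≤ (1 - 1/m)
H`. This contraction lets lower Bellman bounds pass to the limit for every policy. -/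
theorem le_iSup_expSum {r : Fin S → Fin A → ℝ} (hr : ∀ s a, 0 ≤ r s a) {Φ : Fin S → ℝ}
    (hΦ : ∀ s, 0 ≤ Φ s) (π : SSPPolicy S A)
    (h : ∀ t s a, (π t s : Fin A → ℝ) a ≠ 0 → Φ s ≤ r s a + p.back g Φ s a) (s : Fin S) :
    ENNReal.ofReal (Φ s) ≤
      ⨆ n, (p.inst g).expSum (fun s a => ENNReal.ofReal (r s a)) n π s := by
  set H := p.pot p.T (p.T₁ + p.T / 4) 1 with hHdef
  set m := 7 / 4 * p.T + p.K / 8 with hm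
  have hm1 : 1 ≤ m := by linarith [p.two_le_T, p.T_le_K]
  have hH1 : ∀ s, 1 ≤ H s := fun s =>
    (le_add_of_nonneg_right (p.back_nonneg g p.pot_hitting_nonneg s p.fast)).trans
      (p.one_add_back_pot_le g s p.fast)
  refine (p.inst g).le_iSup_expSum _ (fun s => ENNReal.ofReal (Φ s))
    (fun s => ENNReal.ofReal (H s)) (ENNReal.ofReal (1 - 1 / m))
    (ENNReal.ofReal (∑ s, Φ s)) ?_ ENNReal.ofReal_ne_top (fun _ => ENNReal.ofReal_ne_top) ?_ ?_
    π s ?_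
  · rw [ENNReal.ofReal_lt_one]
    have : 0 < 1 / m := by positivity
    linarith
  · intro s a
    have h1 : 1 / m ≤ 1 := by rw [div_le_one (by linarith)]; exact hm1
    rw [p.sum_trans_mul_ofReal g p.pot_hitting_nonneg, ← ENNReal.ofReal_mul (by linarith)]
    refine ENNReal.ofReal_le_ofReal ?_
    have h2 := p.one_add_back_pot_le g s a
    have h3 : 1 / m * H s ≤ 1 := by
      rw [div_mul_eq_mul_div, one_mul, div_le_one (by linarith)]
      exact p.pot_hitting_le s
    linarith
  · intro s
    rw [← ENNReal.ofReal_mul (Finset.sum_nonneg fun s _ => hΦ s)]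
    refine ENNReal.ofReal_le_ofReal ((Finset.single_le_sum (fun s _ => hΦ s)
      (Finset.mem_univ s)).trans ?_)
    exact le_mul_of_one_le_right (Finset.sum_nonneg fun s _ => hΦ s) (hH1 s)
  · intro t s a ha
    rw [p.sum_trans_mul_ofReal g hΦ, ← ENNReal.ofReal_add (hr s a) (p.back_nonneg g hΦ s a)]
    exact ENNReal.ofReal_le_ofReal (h t s a ha)

end HardParams

/-! ### Optimal values and the effect of a perturbation -/

namespace HardParams

variable {S A : ℕ} (p : HardParams S A) (g : Fin S → Fin A → unitInterval)

/-- The optimal value of a node at the deepest level of the heap. -/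
noncomputable def w₀ : ℝ := p.cmin * p.T₁ + p.B / 4 - 3 * p.ε

/-- The optimal value function of the unperturbed instance. -/
noncomputable def W : Fin S → ℝ := p.pot p.B p.w₀ p.cmin

theorem w₀_ge : 3 / 8 ≤ p.w₀ := by
  unfold w₀
  nlinarith [p.cmin_mul_T₁_nonneg, p.cmin_nonneg, p.two_le_B, p.ε_lt]

theorem W_nonneg (s : Fin S) : 0 ≤ p.W s :=
  p.pot_nonneg p.B_pos.le (by linarith [p.w₀_ge]) p.cmin_nonneg s

theorem W_le (s : Fin S) : p.W s ≤ 2 * p.B := by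
  unfold W pot
  split_ifs
  · linarith [p.B_pos]
  · have h1 := mul_le_mul_of_nonneg_right (p.lack_le s) p.cmin_nonneg
    have h2 := mul_le_mul_of_nonneg_right p.D_add_one_le p.cmin_nonneg
    unfold w₀
    linarith [p.cmin_mul_T_le, p.cmin_mul_T₁, p.ε_pos, p.B_pos]

variable {p} in
theorem Leaf.W_eq {s : Fin S} (hs : p.Leaf s) :
    p.W s = p.cmin * p.T₁ + p.slowProb s * p.B - 3 * p.ε := by
  have hB := p.B_pos.ne'
  unfold W w₀ slowProb
  rw [p.pot_of_ne _ _ _ hs.ne_sink]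
  field_simp
  ring

theorem W_sink : p.W p.sink = p.B := p.pot_sink _ _ _

theorem cost_sink (a : Fin A) : p.cost p.sink a = p.B / p.T := if_pos rfl

theorem cost_of_ne {s : Fin S} (hs : s ≠ p.sink) (a : Fin A) : p.cost s a = p.cmin := if_neg hs

theorem cost_add_back_sink {Φ : Fin S → ℝ} (hΦ : Φ p.sink = p.B) (a : Fin A) :
    p.cost p.sink a + p.back g Φ p.sink a = p.B := by
  rw [p.cost_sink, back_sink, hΦ]
  ring

variable {p} in
theorem Inner.cost_add_back_W {s : Fin S} (hs : p.Inner s) (a : Fin A) :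
    p.cost s a + p.back g p.W s a = p.W s := by
  unfold W
  rw [hs.back_pot, p.cost_of_ne hs.ne_sink]
  ring

variable {p} in
theorem Leaf.cost_add_back_fast {Φ : Fin S → ℝ} (hΦ : Φ p.sink = p.B) {s : Fin S}
    (hs : p.Leaf s) : p.cost s p.fast + p.back g Φ s p.fast = p.W s := by
  have hB := p.B_pos.ne'
  rw [hs.back_fast, p.cost_of_ne hs.ne_sink, hΦ, hs.W_eq]
  unfold fastProb
  field_simp
  ring

variable {p} in
theorem Leaf.cost_add_back_slow {Φ : Fin S → ℝ} (hΦ : Φ p.sink = p.B) {s : Fin S}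
    (hs : p.Leaf s) {a : Fin A} (ha : a ≠ p.fast) : p.cost s a + p.back g Φ s a =
      Φ s + (p.W s - Φ s + 3 * p.ε - 6 * p.ε * g s a) / p.T₁ := by
  have hB := p.B_pos.ne'
  have hT₁ := p.T₁_pos.ne'
  rw [hs.back_slow _ _ ha, p.cost_of_ne hs.ne_sink, hΦ, hs.W_eq]
  field_simp
  ring

/-- With at most half of the perturbation, no action improves on `W`. -/
theorem W_le_cost_add_back (hg : ∀ s a, (g s a : ℝ) ≤ 1 / 2) (s : Fin S) (a : Fin A) :
    p.W s ≤ p.cost s a + p.back g p.W s a := by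
  rcases p.trichotomy s with rfl | hs | hs
  · rw [p.cost_add_back_sink g p.W_sink, W_sink]
  · rw [hs.cost_add_back_W]
  · by_cases ha : a = p.fast
    · rw [ha, hs.cost_add_back_fast g p.W_sink]
    · rw [hs.cost_add_back_slow g p.W_sink ha]
      refine le_add_of_nonneg_right (div_nonneg ?_ p.T₁_pos.le)
      -- The advantage `3ε - 6ε g` of the fast action vanishes exactly at `g = 1/2`.
      nlinarith [hg s a, p.ε_pos]

theorem W_le_value (hg : ∀ s a, (g s a : ℝ) ≤ 1 / 2) (π : SSPPolicy S A) (s : Fin S) :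
    ENNReal.ofReal (p.W s) ≤ (p.inst g).value π s :=
  p.le_iSup_expSum g p.cost_nonneg p.W_nonneg π (fun _ s a _ => p.W_le_cost_add_back g hg s a) s

theorem zero_le_half (s : Fin S) (a : Fin A) :
    (((0 : Fin S → Fin A → unitInterval) s a : unitInterval) : ℝ) ≤ 1 / 2 := by
  simp

theorem value_fast_le (s : Fin S) :
    (p.inst 0).value (fun _ => detRule fun _ => p.fast) s ≤ ENNReal.ofReal (p.W s) := by
  refine p.iSup_expSum_le 0 p.cost_nonneg p.W_nonneg _ (fun _ s a ha => ?_) s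
  rw [SSP.eq_of_detRule_ne_zero ha]
  rcases p.trichotomy s with rfl | hs | hs
  · rw [p.cost_add_back_sink _ p.W_sink, W_sink]
  · rw [hs.cost_add_back_W]
  · rw [hs.cost_add_back_fast _ p.W_sink]

theorem optValue_eq (s : Fin S) : (p.inst 0).optValue s = ENNReal.ofReal (p.W s) :=
  le_antisymm (((p.proper 0 _).optValue_le s).trans (p.value_fast_le s))
    (le_iInf₂ fun _ _ => p.W_le_value 0 zero_le_half _ s)

theorem isOptimal_fast : (p.inst 0).IsOptimal fun _ => p.fast :=
  ⟨p.proper 0 _, fun s => le_antisymm ((p.value_fast_le s).trans_eq (p.optValue_eq s).symm)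
    ((p.proper 0 _).optValue_le s)⟩

theorem Bstar_le : (p.inst 0).Bstar ≤ ENNReal.ofReal (2 * p.B) :=
  iSup_le fun s => (p.optValue_eq s).trans_le (ENNReal.ofReal_le_ofReal (p.W_le s))

theorem le_Bstar : ENNReal.ofReal p.B ≤ (p.inst 0).Bstar := by
  refine le_trans ?_ (le_iSup _ p.sink)
  rw [p.optValue_eq, W_sink]

/-- An optimal policy of the unperturbed instance takes the fast action in every leaf. -/
theorem eq_fast_of_isOptimal {f : Fin S → Fin A} (hf : (p.inst 0).IsOptimal f) {s : Fin S}
    (hs : p.Leaf s) : f s = p.fast := by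
  by_contra hne
  -- Raising `W` by `3ε` at the leaves where `f` is slow keeps the lower Bellman bound along `f`,
  -- with equality at these leaves. So `f` would lose `3ε` there.
  set Φ : Fin S → ℝ := fun u => p.W u + if p.Leaf u ∧ f u ≠ p.fast then 3 * p.ε else 0 with hΦdef
  have hWΦ : ∀ u, p.W u ≤ Φ u := fun u => by
    refine le_add_of_nonneg_right ?_
    split_ifs <;> linarith [p.ε_pos]
  have hΦsink : Φ p.sink = p.B := by
    have : ¬ p.Leaf p.sink := fun h => h.ne_sink rfl
    simp [hΦdef, this, W_sink]
  have h := p.le_iSup_expSum 0 p.cost_nonneg (fun u => (p.W_nonneg u).trans (hWΦ u))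
    (fun _ => detRule f) (fun _ u a ha => ?_) s
  · have h2 : ENNReal.ofReal (Φ s) ≤ ENNReal.ofReal (p.W s) :=
      (h.trans_eq (hf.2 s)).trans_eq (p.optValue_eq s)
    rw [ENNReal.ofReal_le_ofReal_iff (p.W_nonneg s)] at h2
    simp only [hΦdef, if_pos (And.intro hs hne)] at h2
    linarith [p.ε_pos]
  · rw [SSP.eq_of_detRule_ne_zero ha]
    by_cases hu : p.Leaf u ∧ f u ≠ p.fast
    · rw [hu.1.cost_add_back_slow 0 hΦsink hu.2]
      simp [hΦdef, if_pos hu]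
    · have h1 : Φ u = p.W u := by simp only [hΦdef, if_neg hu, add_zero]
      rw [h1]
      exact (p.W_le_cost_add_back 0 zero_le_half u (f u)).trans
        (add_le_add le_rfl (p.back_mono 0 hWΦ u (f u)))

/-- `T₁` does not enter, since optimal policies are fast in every leaf. The constant `3/8` is `1/4`
from `slowProb` plus `1/8` from the compensated waiting cost. -/
theorem Tstar_le : (p.inst 0).Tstar ≤ ENNReal.ofReal (2 * p.T) := by
  refine iSup₂_le fun f hf => iSup_le fun s => ?_
  have hnn : ∀ s, 0 ≤ p.pot p.T (1 + 3 / 8 * p.T) 1 s :=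
    p.pot_nonneg p.T_pos.le (by linarith [p.T_pos]) zero_le_one
  have h := p.iSup_expSum_le 0 (r := fun _ _ => 1) (fun _ _ => zero_le_one) hnn
    (fun _ => detRule f) (fun _ u a ha => ?_) s
  · simp only [ENNReal.ofReal_one] at h
    refine le_trans h (ENNReal.ofReal_le_ofReal ?_)
    unfold pot
    split_ifs
    · linarith [p.T_pos]
    · linarith [p.lack_le s, p.D_add_one_le, p.T_pos]
  · rw [SSP.eq_of_detRule_ne_zero ha]
    rcases p.trichotomy u with rfl | hu | hu
    · have hT := p.T_pos.ne'
      rw [back_sink, pot_sink]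
      field_simp
      linarith
    · rw [hu.back_pot]
      linarith
    · rw [p.eq_fast_of_isOptimal hf hu, hu.back_fast, pot_sink, p.pot_of_ne _ _ _ hu.ne_sink]
      have h1 := p.slowProb_mul_T_le hu.ne_sink
      have h2 : p.fastProb u * p.T = p.slowProb u * p.T +
          p.cmin * (p.T₁ - 1) / p.B * p.T - 3 * p.ε / p.B * p.T := by unfold fastProb; ring
      have h3 : p.cmin * (p.T₁ - 1) / p.B ≤ 1 / 8 := by
        rw [div_le_div_iff₀ p.B_pos (by norm_num)]
        linarith [p.cmin_mul_T₁]
      have h4 := mul_le_mul_of_nonneg_right h3 p.T_pos.le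
      have h5 : 0 ≤ 3 * p.ε / p.B * p.T :=
        mul_nonneg (div_nonneg (by linarith [p.ε_pos]) p.B_pos.le) p.T_pos.le
      linarith

theorem le_Tstar : ENNReal.ofReal p.T ≤ (p.inst 0).Tstar := by
  refine le_trans ?_ (le_iSup₂_of_le _ p.isOptimal_fast (le_iSup _ p.sink))
  have hnn : ∀ s, 0 ≤ (if s = p.sink then p.T else 0) := fun s => by
    split_ifs
    exacts [p.T_pos.le, le_rfl]
  have h := p.le_iSup_expSum 0 (r := fun _ _ => 1) (fun _ _ => zero_le_one) hnn
    (fun _ => detRule fun _ => p.fast) (fun _ u a _ => ?_) p.sink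
  · simp only [ENNReal.ofReal_one, if_true] at h
    exact h
  · have h1 := p.back_nonneg 0 hnn u a
    split_ifs with hu
    · have hT := p.T_pos.ne'
      rw [hu, back_sink, if_pos rfl]
      field_simp
      linarith
    · linarith

theorem hasMinCost : (p.inst g).HasMinCost p.cmin := by
  refine ⟨⟨(p.root, p.fast), p.cost_of_ne p.root_ne_sink p.fast⟩, ?_⟩
  rintro _ ⟨⟨s, a⟩, rfl⟩
  change p.cmin ≤ p.cost s a
  unfold cost
  split_ifs
  exacts [p.cmin_le_div, le_rfl]

/-- Every policy has hitting time at most `7/4 * T + K / 8`, and `2 * T ≤ Tbar` and `K ≤ Tbar` bound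
this by `7/8 * Tbar + 1/8 * Tbar`. -/
theorem inst_mem_sspClass {Tbar : ℝ≥0∞} (hT : ENNReal.ofReal (2 * p.T) ≤ Tbar)
    (hK : ENNReal.ofReal p.K ≤ Tbar) : p.inst g ∈ sspClass S A p.cmin Tbar := by
  refine ⟨⟨detRule fun _ => p.fast, p.proper g _⟩, p.hasMinCost g,
    iSup₂_le fun f _ => iSup_le fun s => (p.hittingTime_le g _ s).trans ?_⟩
  rcases eq_or_ne Tbar ⊤ with rfl | hne
  · exact le_top
  rw [ENNReal.ofReal_le_iff_le_toReal hne] at hT hK ⊢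
  linarith [p.pot_hitting_le s]

theorem expSum_succ (r : Fin S → Fin A → ℝ≥0∞) (n : ℕ) (π : SSPPolicy S A) (s : Fin S) :
    (p.inst g).expSum r (n + 1) π s = ∑ a, ENNReal.ofReal ((π 0 s : Fin A → ℝ) a) * (r s a +
      (ENNReal.ofReal (p.moveProb s a) *
          (p.inst g).expSum r n (fun t => π (t + 1)) (p.tgt s a) +
        ENNReal.ofReal (p.sinkProb g s a) *
          (p.inst g).expSum r n (fun t => π (t + 1)) p.sink)) := by
  rw [SSP.expSum]
  simp only [sum_trans_mul]

/-- The sink never leads back to the heap, so the perturbation is not felt there. Hence no path uses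
a perturbed probability of failing twice, which makes the expected sums affine. -/
theorem expSum_sink_congr (g g' : Fin S → Fin A → unitInterval) (r : Fin S → Fin A → ℝ≥0∞)
    (n : ℕ) : ∀ π : SSPPolicy S A,
      (p.inst g).expSum r n π p.sink = (p.inst g').expSum r n π p.sink := by
  induction n with
  | zero => intro π; rfl
  | succ n ih =>
    intro π
    have h : ∀ a, p.tgt p.sink a = p.sink :=
      p.tgt_of_not_inner fun h => h.ne_sink rfl
    simp only [expSum_succ, h, ih]
    simp [sinkProb]

/-- The expected sums are affine in the perturbation. -/
theorem expSum_add_expSum {g₀ g₁ g₂ : Fin S → Fin A → unitInterval}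
    (hg : ∀ s a, (g₀ s a : ℝ) + g₁ s a = 2 * g₂ s a) (r : Fin S → Fin A → ℝ≥0∞) (n : ℕ) :
    ∀ (π : SSPPolicy S A) (s : Fin S), (p.inst g₀).expSum r n π s + (p.inst g₁).expSum r n π s =
      2 * (p.inst g₂).expSum r n π s := by
  induction n with
  | zero => intro π s; simp [SSP.expSum]
  | succ n ih =>
    intro π s
    simp only [expSum_succ, Finset.mul_sum, ← Finset.sum_add_distrib]
    refine Finset.sum_congr rfl fun a _ => ?_
    have hs : ENNReal.ofReal (p.sinkProb g₀ s a) + ENNReal.ofReal (p.sinkProb g₁ s a) =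
        2 * ENNReal.ofReal (p.sinkProb g₂ s a) := by
      rw [← ENNReal.ofReal_add (p.sinkProb_nonneg _ _ _) (p.sinkProb_nonneg _ _ _),
        ← ENNReal.ofReal_ofNat 2, ← ENNReal.ofReal_mul (by norm_num)]
      congr 1
      unfold sinkProb
      split_ifs
      · ring
      · ring
      · ring
      · rw [← add_div, ← mul_div_assoc]
        congr 1
        linear_combination (-(6 * p.ε / p.B)) * hg s a
    rw [p.expSum_sink_congr g₁ g₀, p.expSum_sink_congr g₂ g₀]
    have hm := ih (fun t => π (t + 1)) (p.tgt s a)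
    set e := (p.inst g₀).expSum r n (fun t => π (t + 1)) p.sink
    set m := ENNReal.ofReal (p.moveProb s a)
    calc _ = ENNReal.ofReal ((π 0 s : Fin A → ℝ) a) * (2 * r s a +
          (m * ((p.inst g₀).expSum r n (fun t => π (t + 1)) (p.tgt s a) +
            (p.inst g₁).expSum r n (fun t => π (t + 1)) (p.tgt s a)) +
          (ENNReal.ofReal (p.sinkProb g₀ s a) + ENNReal.ofReal (p.sinkProb g₁ s a)) * e)) := by
          ring
      _ = _ := by rw [hm, hs]; ring

/-- Average the two instances: at the midpoint `g₂ ≤ 1/2`, so `W` still bounds the value of every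
policy from below. -/
theorem two_mul_W_le {g₁ g₂ : Fin S → Fin A → unitInterval}
    (hg : ∀ s a, (g₁ s a : ℝ) = 2 * g₂ s a) (π : SSPPolicy S A) (s : Fin S) :
    2 * ENNReal.ofReal (p.W s) ≤ (p.inst 0).value π s + (p.inst g₁).value π s := by
  have hhalf : ∀ s a, (g₂ s a : ℝ) ≤ 1 / 2 := fun s a => by
    have := (g₁ s a).2.2
    have := hg s a
    linarith
  refine (mul_le_mul_right (p.W_le_value g₂ hhalf π s) 2).trans ?_
  unfold SSP.value
  rw [ENNReal.mul_iSup]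
  refine iSup_le fun n => ?_
  change 2 * (p.inst g₂).expSum (fun u a => ENNReal.ofReal (p.cost u a)) n π s ≤ _
  rw [← p.expSum_add_expSum (g₀ := 0) (g₁ := g₁) (fun s a => by simpa using hg s a)]
  exact add_le_add
    (le_iSup (fun n => (p.inst 0).expSum (fun u a => ENNReal.ofReal (p.cost u a)) n π s) n)
    (le_iSup (fun n => (p.inst g₁).expSum (fun u a => ENNReal.ofReal (p.cost u a)) n π s) n)

/-- The perturbation of a single state-action pair. -/
noncomputable def single (z : Fin S × Fin A) (s : Fin S) (a : Fin A) : unitInterval :=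
  if (s, a) = z then 1 else 0

theorem single_self (z : Fin S × Fin A) : single z z.1 z.2 = 1 := if_pos rfl

/-- Perturbing a slow action in a leaf improves the optimal value. -/
theorem optValue_single_le {z : Fin S × Fin A} (hz : p.Leaf z.1) (hz' : z.2 ≠ p.fast) :
    (p.inst (single z)).optValue p.root ≤ ENNReal.ofReal (p.W p.root - 3 * p.ε) := by
  classical
  -- The policy that walks down to the leaf `z.1` and then plays `z.2` gains `3ε` at every node on
  -- its path.
  set U : Fin S → ℝ := fun s => p.W s - if IsHeapAncestor A z.1 s then 3 * p.ε else 0 with hU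
  have hA : 1 ≤ A := le_trans (by norm_num) p.three_le_A
  have hanc : ∀ {s : Fin S}, IsHeapAncestor A z.1 s → s ≠ p.sink := fun {s} hs => by
    have := hs.le
    have := hz.1
    rw [ne_sink_iff]
    omega
  have hUsink : U p.sink = p.B := by
    have : ¬ IsHeapAncestor A z.1 p.sink := fun h => hanc h rfl
    simp only [hU, if_neg this, W_sink, sub_zero]
  have hUW : ∀ s, U s ≤ p.W s := fun s => by
    refine sub_le_self _ ?_
    split_ifs <;> linarith [p.ε_pos]
  have hU0 : ∀ s, 0 ≤ U s := fun s => by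
    by_cases hs : IsHeapAncestor A z.1 s
    · simp only [hU, if_pos hs]
      unfold W
      rw [p.pot_of_ne _ _ _ (hanc hs)]
      linarith [p.w₀_ge, p.ε_lt, mul_nonneg (p.lack_nonneg (hanc hs)) p.cmin_nonneg]
    · simpa only [hU, if_neg hs, sub_zero] using p.W_nonneg s
  have hstep : ∀ s, ∃ a, p.cost s a + p.back (single z) U s a ≤ U s := fun s => by
    rcases p.trichotomy s with rfl | hs | hs
    · exact ⟨p.fast, by rw [p.cost_add_back_sink _ hUsink, hUsink]⟩
    · by_cases hsz : IsHeapAncestor A z.1 s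
      · obtain ⟨a, ha, hc⟩ := hsz.exists_child hA fun h => hz.not_inner (Fin.ext h ▸ hs)
        have hlt : A * s + a + 1 < S - 1 := lt_of_le_of_lt hc.le hz.1
        refine ⟨⟨a, ha⟩, ?_⟩
        have htgt : IsHeapAncestor A z.1 (p.tgt s ⟨a, ha⟩) := by
          unfold tgt
          rwa [dif_pos hlt]
        have h1 := hs.cost_add_back_W (single z) ⟨a, ha⟩
        rw [hs.back] at h1 ⊢
        simp only [hU, if_pos hsz, if_pos htgt]
        linarith
      · refine ⟨p.fast, ?_⟩
        have h1 : U s = p.W s := by simp only [hU, if_neg hsz, sub_zero]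
        rw [h1, ← hs.cost_add_back_W (single z) p.fast]
        exact add_le_add le_rfl (p.back_mono _ hUW s _)
    · by_cases hsz : s = z.1
      · refine ⟨z.2, ?_⟩
        have hself : IsHeapAncestor A z.1 z.1 := .self
        rw [hsz, hz.cost_add_back_slow _ hUsink hz', single_self]
        simp only [hU, if_pos hself, Set.Icc.coe_one]
        refine le_of_eq ?_
        ring
      · refine ⟨p.fast, ?_⟩
        have hsz' : ¬ IsHeapAncestor A z.1 s := fun h => by
          obtain ⟨a, ha, hc⟩ := h.exists_child hA fun h => hsz (Fin.ext h)
          have h1 := hc.le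
          have h2 := hz.1
          have h3 := hs.2
          omega
        rw [hs.cost_add_back_fast _ hUsink]
        simp only [hU, if_neg hsz', sub_zero, le_refl]
  choose f hf using hstep
  refine ((p.proper _ (detRule f)).optValue_le p.root).trans ?_
  refine (p.iSup_expSum_le (single z) p.cost_nonneg hU0 (fun _ => detRule f)
    (fun _ s a ha => ?_) p.root).trans_eq ?_
  · rw [SSP.eq_of_detRule_ne_zero ha]
    exact hf s
  · have : IsHeapAncestor A z.1 p.root := IsHeapAncestor.self.zero
    simp only [hU, if_pos this]

/-- No policy is good on both the unperturbed and a perturbed instance. -/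
theorem disjoint_isEpsOptimal {z : Fin S × Fin A} (hz : p.Leaf z.1) (hz' : z.2 ≠ p.fast) :
    Disjoint {π | (p.inst 0).IsEpsOptimal p.ε π} {π | (p.inst (single z)).IsEpsOptimal p.ε π} := by
  refine Set.disjoint_left.2 fun π h₀ h₁ => ?_
  have hW : 3 / 8 ≤ p.W p.root := by
    unfold W
    rw [p.pot_of_ne _ _ _ p.root_ne_sink]
    linarith [p.w₀_ge, mul_nonneg (p.lack_nonneg p.root_ne_sink) p.cmin_nonneg]
  have hsum := p.two_mul_W_le (g₁ := single z)
    (g₂ := fun s a => if (s, a) = z then ⟨1 / 2, by norm_num, by norm_num⟩ else 0)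
    (fun s a => by unfold single; split_ifs <;> simp) π p.root
  have h₀' : (p.inst 0).value π p.root ≤ ENNReal.ofReal (p.W p.root) + ENNReal.ofReal p.ε :=
    (p.optValue_eq p.root) ▸ h₀
  have h₁' : (p.inst (single z)).value π p.root ≤
      ENNReal.ofReal (p.W p.root - 3 * p.ε) + ENNReal.ofReal p.ε :=
    le_trans h₁ (add_le_add (p.optValue_single_le hz hz') le_rfl)
  -- In real numbers this reads `2W ≤ (W + ε) + (W - 3ε + ε) = 2W - ε`.
  have h := hsum.trans (add_le_add h₀' h₁')
  have hε := p.ε_pos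
  have hε' := p.ε_lt
  rw [← ENNReal.ofReal_add (by linarith) hε.le, ← ENNReal.ofReal_add (by linarith) hε.le,
    ← ENNReal.ofReal_add (by linarith) (by linarith), ← ENNReal.ofReal_ofNat 2,
    ← ENNReal.ofReal_mul (by norm_num), ENNReal.ofReal_le_ofReal_iff (by linarith)] at h
  linarith

end HardParams

/-! ### Relative entropy and the count of hard pairs -/

namespace HardParams

variable {S A : ℕ} (p : HardParams S A)

/-- The log-likelihood ratio of a transition in the unperturbed instance and in the one perturbed
at `z`. -/
noncomputable def logRatio (z x : Fin S × Fin A) (y : Option (Fin S)) : ℝ :=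
  if x = z then
    (if y = some p.sink then
      Real.log (p.slowProb z.1 / (p.slowProb z.1 - 6 * p.ε / p.B))
    else if y = none then
      Real.log ((1 - p.slowProb z.1) / (1 - (p.slowProb z.1 - 6 * p.ε / p.B)))
    else 0)
  else 0

variable {p} {z : Fin S × Fin A}

theorem weight_slow (g : Fin S → Fin A → unitInterval) (hz : p.Leaf z.1) (hz' : z.2 ≠ p.fast)
    (y : Option (Fin S)) : p.weight g z.1 z.2 y =
      (if y = some z.1 then 1 - 1 / p.T₁ else 0) +
      (if y = some p.sink then (p.slowProb z.1 - 6 * p.ε / p.B * g z.1 z.2) / p.T₁ else 0) +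
      (if y = none then (1 - (p.slowProb z.1 - 6 * p.ε / p.B * g z.1 z.2)) / p.T₁ else 0) := by
  simp only [weight, moveProb, sinkProb, hz.ne_sink, hz.not_inner, hz', if_false,
    p.tgt_of_not_inner hz.not_inner]
  congr 2
  ring

/-- The bounds on `slowProb` and on `6 * ε / B` keep both failure and success probabilities positive
after the perturbation, so the logarithms are meaningful; staying has the same probability in both
instances. -/
theorem trans_single_eq (hz : p.Leaf z.1) (hz' : z.2 ≠ p.fast) (x : Fin S × Fin A)
    (y : Option (Fin S)) : ((p.inst (single z)).trans x.1 x.2 y).toReal =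
      ((p.inst 0).trans x.1 x.2 y).toReal * Real.exp (-p.logRatio z x y) := by
  rw [toReal_trans, toReal_trans]
  by_cases hx : x = z
  · subst hx
    have h1 := p.quarter_le_slowProb hz.ne_sink
    have h2 := hz.slowProb_le
    have h3 := p.gap_le
    have h4 := p.gap_pos
    have hT := p.T₁_pos.ne'
    rw [weight_slow _ hz hz', weight_slow _ hz hz', single_self]
    rcases y with _ | y
    · have h5 : 1 - (p.slowProb x.1 - 6 * p.ε / p.B) ≠ 0 := by linarith
      have h6 : 1 - p.slowProb x.1 ≠ 0 := by linarith
      simp only [logRatio, reduceCtorEq, if_true, if_false, zero_add, Pi.zero_apply,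
        Set.Icc.coe_zero, Set.Icc.coe_one, mul_zero, mul_one, sub_zero]
      rw [← Real.log_inv, Real.exp_log (inv_pos.2 (div_pos (by linarith) (by linarith)))]
      generalize 6 * p.ε / p.B = γ at *
      field_simp
    · by_cases hy : y = p.sink
      · have h5 : p.slowProb x.1 - 6 * p.ε / p.B ≠ 0 := by linarith
        have h6 : p.slowProb x.1 ≠ 0 := by linarith
        have h7 : p.sink ≠ x.1 := hz.ne_sink.symm
        simp only [logRatio, hy, h7, Option.some.injEq, reduceCtorEq, if_true, if_false, zero_add,
          add_zero, Pi.zero_apply, Set.Icc.coe_zero, Set.Icc.coe_one, mul_zero, mul_one, sub_zero]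
        rw [← Real.log_inv, Real.exp_log (inv_pos.2 (div_pos (by linarith) (by linarith)))]
        generalize 6 * p.ε / p.B = γ at *
        field_simp
      · simp [logRatio, hy]
  · have h : (single z x.1 x.2 : unitInterval) = 0 := if_neg hx
    simp [logRatio, hx, weight, sinkProb, h]

theorem mul_log_div_le {a b : ℝ} (ha : 0 < a) (hb : 0 < b) :
    a * Real.log (a / b) ≤ a * (a / b - 1) :=
  mul_le_mul_of_nonneg_left (Real.log_le_sub_one_of_pos (div_pos ha hb)) ha.le

/-- The relative entropy of the outcomes of a query is small. -/
theorem sum_logRatio_le (hz : p.Leaf z.1) (hz' : z.2 ≠ p.fast) :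
    ∑ y, ((p.inst 0).trans z.1 z.2 y).toReal * p.logRatio z z y ≤
      1152 * p.ε ^ 2 / (p.B ^ 2 * p.T₁) := by
  have h1 := p.quarter_le_slowProb hz.ne_sink
  have h2 := hz.slowProb_le
  have h3 := p.gap_le
  have h4 := p.gap_pos
  have hT := p.T₁_pos
  have hB := p.B_pos
  have hsum : ∑ y, ((p.inst 0).trans z.1 z.2 y).toReal * p.logRatio z z y =
      ((1 - p.slowProb z.1) *
          Real.log ((1 - p.slowProb z.1) / (1 - (p.slowProb z.1 - 6 * p.ε / p.B))) +
        p.slowProb z.1 * Real.log (p.slowProb z.1 / (p.slowProb z.1 - 6 * p.ε / p.B))) /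
      p.T₁ := by
    rw [Fintype.sum_option, Finset.sum_eq_single p.sink]
    · rw [toReal_trans, toReal_trans, weight_slow _ hz hz', weight_slow _ hz hz']
      have h7 : p.sink ≠ z.1 := hz.ne_sink.symm
      simp only [logRatio, h7, Option.some.injEq, reduceCtorEq, if_true, if_false, zero_add,
        add_zero, Pi.zero_apply, Set.Icc.coe_zero, mul_zero, sub_zero]
      ring
    · intro y _ hy
      simp [logRatio, hy]
    · simp
  have hγ : (6 * p.ε / p.B) ^ 2 * 32 / p.T₁ = 1152 * p.ε ^ 2 / (p.B ^ 2 * p.T₁) := by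
    field_simp
    ring
  rw [hsum, ← hγ]
  generalize 6 * p.ε / p.B = γ at *
  generalize p.slowProb z.1 = b at *
  refine div_le_div_of_nonneg_right ?_ hT.le
  have h5 : 0 < b - γ := by linarith
  have h6 : 0 < 1 - (b - γ) := by linarith
  -- Relative entropy is bounded by the chi-square divergence.
  have h7 := mul_log_div_le (a := 1 - b) (by linarith) h6
  have h8 := mul_log_div_le (a := b) (by linarith) h5
  have h9 : (1 - b) * ((1 - b) / (1 - (b - γ)) - 1) + b * (b / (b - γ) - 1) =
      γ ^ 2 / ((b - γ) * (1 - (b - γ))) := by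
    field_simp
    ring
  have h10 : γ ^ 2 / ((b - γ) * (1 - (b - γ))) ≤ γ ^ 2 * 32 := by
    rw [div_le_iff₀ (mul_pos h5 h6)]
    -- Here `b - γ` lies between `5/32` and `3/4`.
    have : 1 / 32 ≤ (b - γ) * (1 - (b - γ)) := by nlinarith
    nlinarith [sq_nonneg γ]
  linarith

variable (p)

/-- The slow actions in the leaves. -/
def hardPairs : Finset (Fin S × Fin A) :=
  (Finset.univ.filter p.Leaf) ×ˢ (Finset.univ.erase p.fast)

/-- As `A ≥ 3`, nodes of index at least `(S - 1) / 2` have no child, so at least `S / 4` states are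
leaves. At least `2 A / 3` of the actions are slow. -/
theorem card_hardPairs : (S : ℝ) * A ≤ 6 * (p.hardPairs.card : ℝ) := by
  have hS := p.two_le_S
  have hA := p.three_le_A
  have h1 : S ≤ 4 * (Finset.univ.filter p.Leaf).card := by
    have hsub : Finset.Ico (⟨(S - 1) / 2, by omega⟩ : Fin S) p.sink ⊆
        Finset.univ.filter p.Leaf := by
      intro s hs
      rw [Finset.mem_Ico, Fin.le_def, Fin.lt_def] at hs
      obtain ⟨hs1, hs2⟩ := hs
      change (S - 1) / 2 ≤ (s : ℕ) at hs1
      change (s : ℕ) < S - 1 at hs2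
      refine Finset.mem_filter.2 ⟨Finset.mem_univ _, hs2, ?_⟩
      have := Nat.mul_le_mul_right (s : ℕ) hA
      omega
    have h := Finset.card_le_card hsub
    rw [Fin.card_Ico] at h
    change S - 1 - (S - 1) / 2 ≤ _ at h
    omega
  have h2 : 2 * A ≤ 3 * (Finset.univ.erase p.fast).card := by
    rw [Finset.card_erase_of_mem (Finset.mem_univ _), Finset.card_univ, Fintype.card_fin]
    omega
  have h3 : S * A ≤ 6 * p.hardPairs.card := by
    have := Nat.mul_le_mul h1 h2
    unfold hardPairs
    rw [Finset.card_product]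
    nlinarith
  exact_mod_cast h3

/-- The lower bound on the number of queries in terms of the parameters. -/
theorem le_queries {alg : LearningAlgorithm S A} {δ : ℝ} (hδ : 0 < δ)
    (hδ' : δ < 1 / (2 * Real.exp 4)) {C : Set (SSP S A)} (hC : ∀ g, p.inst g ∈ C)
    {n : SSP S A → ℕ∞} (hn : alg.IsCorrect p.ε δ C n) {N : ℕ} (hN : n (p.inst 0) = N) :
    p.K * p.B ^ 2 * S * A / p.ε ^ 2 * Real.log (1 / δ) ≤ 110592 * N := by
  have hT := p.T₁_pos
  have hB := p.B_pos
  have hε := p.ε_pos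
  have hlaw := alg.isTranscriptLaw (p.inst 0)
  set E := IsTranscriptLaw.expectedQueries (alg.queryProb (p.inst 0))
    (fun h => (alg.transcriptProb (p.inst 0) h).toReal) N with hE
  have hE0 : ∀ x, 0 ≤ E x := fun x => Finset.sum_nonneg fun _ _ => Finset.sum_nonneg fun _ _ =>
    mul_nonneg ENNReal.toReal_nonneg ENNReal.toReal_nonneg
  have hEsum : ∑ x, E x ≤ N := hlaw.sum_expectedQueries_le
    (LearningAlgorithm.sum_trans_toReal _) (fun _ _ => ENNReal.toReal_nonneg)
    (fun _ _ => ENNReal.toReal_nonneg) (fun h => by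
      have h1 := alg.sum_queryProb_add (p.inst 0) h
      have h2 : 0 ≤ (alg.decideOn (p.inst 0) h (Set.range Sum.inr)).toReal :=
        ENNReal.toReal_nonneg
      linarith) N
  have hpair : ∀ z ∈ p.hardPairs,
      Real.log (1 / δ) / 2 ≤ E z * (1152 * p.ε ^ 2 / (p.B ^ 2 * p.T₁)) := fun z hzmem => by
    obtain ⟨hz, hz'⟩ := Finset.mem_product.1 hzmem
    have hz := (Finset.mem_filter.1 hz).2
    have hz' := Finset.ne_of_mem_erase hz'
    have h₀ := hn _ (hC 0)
    rw [hN] at h₀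
    have h := alg.log_le_sum_expectedQueries (M₀ := p.inst 0) (M₁ := p.inst (single z)) rfl rfl
      hδ hδ' (SSP.measurableSet_isEpsOptimal _ _) (p.disjoint_isEpsOptimal hz hz') h₀
      (hn _ (hC (single z))) (trans_single_eq hz hz')
    rw [Finset.sum_eq_single z] at h
    · exact h.trans (mul_le_mul_of_nonneg_left (sum_logRatio_le hz hz') (hE0 z))
    · intro x _ hx
      simp [logRatio, hx]
    · simp
  have h1 := Finset.sum_le_sum hpair
  rw [Finset.sum_const, nsmul_eq_mul, ← Finset.sum_mul] at h1
  have h2 : ∑ z ∈ p.hardPairs, E z ≤ N :=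
    (Finset.sum_le_univ_sum_of_nonneg hE0).trans hEsum
  have h3 := h1.trans (mul_le_mul_of_nonneg_right h2 (by positivity))
  have hδ1 : δ ≤ 1 := hδ'.le.trans (by
    rw [div_le_one (by positivity)]
    linarith [Real.add_one_le_exp (4 : ℝ)])
  have hL : 0 ≤ Real.log (1 / δ) := Real.log_nonneg (by rwa [le_div_iff₀ hδ, one_mul])
  have hK : p.K ≤ 8 * p.T₁ := by unfold T₁; linarith
  have hcard := p.card_hardPairs
  have hT₁ : p.T₁ * (N * (1152 * p.ε ^ 2 / (p.B ^ 2 * p.T₁))) * (p.B ^ 2 / p.ε ^ 2) =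
      1152 * N := by
    field_simp
  have h4 := mul_le_mul_of_nonneg_right (mul_le_mul_of_nonneg_left h3 hT.le)
    (by positivity : 0 ≤ p.B ^ 2 / p.ε ^ 2)
  rw [hT₁] at h4
  have h5 : p.K * (S * A) ≤ 8 * p.T₁ * (6 * p.hardPairs.card) :=
    mul_le_mul hK hcard (by positivity) (by positivity)
  have h6 := mul_le_mul_of_nonneg_right h5
    (by positivity : 0 ≤ p.B ^ 2 / p.ε ^ 2 * Real.log (1 / δ))
  -- The factor `96` is `8` from `K ≤ 8 T₁`, times `6` from the count of pairs, times `2` from `log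
  -- (1/δ) / 2`.
  calc p.K * p.B ^ 2 * S * A / p.ε ^ 2 * Real.log (1 / δ)
      = p.K * (S * A) * (p.B ^ 2 / p.ε ^ 2 * Real.log (1 / δ)) := by ring
    _ ≤ 8 * p.T₁ * (6 * p.hardPairs.card) * (p.B ^ 2 / p.ε ^ 2 * Real.log (1 / δ)) := h6
    _ = 96 * (p.T₁ * (p.hardPairs.card * (Real.log (1 / δ) / 2)) * (p.B ^ 2 / p.ε ^ 2)) := by
        ring
    _ ≤ 96 * (1152 * N) := mul_le_mul_of_nonneg_left h4 (by norm_num)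
    _ = 110592 * N := by ring

end HardParams

/-! ### Choice of the scale and conclusion -/

/-- The scale of the hitting times: `min (B / cmin) Tbar` as a real number. -/
theorem exists_scale {cmin B T : ℝ} {Tbar : ℝ≥0∞} (hc : 0 ≤ cmin) (hB : 0 < B) (hT : 0 < T)
    (hcT : cmin ≤ B / T) (hTbar : ENNReal.ofReal (2 * T) ≤ Tbar) (hfin : 0 < cmin ∨ Tbar < ⊤) :
    ∃ K : ℝ, T ≤ K ∧ cmin * K ≤ B ∧ ENNReal.ofReal K ≤ Tbar ∧
      min (ENNReal.ofReal (2 * B) / ENNReal.ofReal cmin) Tbar ≤ ENNReal.ofReal (2 * K) := by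
  have hTT : T ≤ 2 * T := by linarith
  rcases hc.eq_or_lt with rfl | hc
  · have hlt : Tbar < ⊤ := hfin.resolve_left (lt_irrefl _)
    have h := (ENNReal.ofReal_le_iff_le_toReal hlt.ne).1 hTbar
    refine ⟨Tbar.toReal, by linarith, by simpa using hB.le, ENNReal.ofReal_toReal_le, ?_⟩
    refine (min_le_right _ _).trans ((ENNReal.le_ofReal_iff_toReal_le hlt.ne ?_).2 ?_) <;> linarith
  have hcT' : T ≤ B / cmin := by
    rw [le_div_iff₀ hc]; rw [le_div_iff₀ hT] at hcT; linarith
  have hdiv : ENNReal.ofReal (2 * B) / ENNReal.ofReal cmin = ENNReal.ofReal (2 * (B / cmin)) := by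
    rw [← ENNReal.ofReal_div_of_pos hc, mul_div_assoc]
  have hcB : cmin * (B / cmin) = B := by field_simp
  by_cases hle : ENNReal.ofReal (B / cmin) ≤ Tbar
  · exact ⟨B / cmin, hcT', hcB.le, hle, (min_le_left _ _).trans hdiv.le⟩
  · have hlt := not_le.1 hle
    have hne : Tbar ≠ ⊤ := hlt.ne_top
    have h := (ENNReal.ofReal_le_iff_le_toReal hne).1 hTbar
    have h2 : Tbar.toReal ≤ B / cmin :=
      (ENNReal.le_ofReal_iff_toReal_le hne (by positivity)).1 hlt.le
    refine ⟨Tbar.toReal, by linarith, ?_, ENNReal.ofReal_toReal_le, ?_⟩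
    · exact (mul_le_mul_of_nonneg_left h2 hc.le).trans hcB.le
    · refine (min_le_right _ _).trans ((ENNReal.le_ofReal_iff_toReal_le hne ?_).2 ?_) <;> linarith

theorem mainTheorem1 :
    ∃ κ : ℝ, 0 < κ ∧
      ∀ (S A : ℕ) (cmin B T₀ : ℝ) (Tbar : ℝ≥0∞) (ε δ : ℝ),
        2 ≤ S → 3 ≤ A → 0 ≤ cmin → 2 ≤ B →
        B ≤ T₀ → Real.logb A S + 1 ≤ T₀ →
        cmin ≤ B / T₀ → ENNReal.ofReal (2 * T₀) ≤ Tbar →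
        (0 < cmin ∨ Tbar < ⊤) →
        0 < ε → ε < 1 / 32 → 0 < δ → δ < 1 / (2 * Real.exp 4) →
        ∃ M₀ ∈ sspClass S A cmin Tbar,
          (ENNReal.ofReal (B / 2) ≤ M₀.Bstar ∧ M₀.Bstar ≤ ENNReal.ofReal (2 * B)) ∧
          (ENNReal.ofReal (T₀ / 2) ≤ M₀.Tstar ∧ M₀.Tstar ≤ ENNReal.ofReal (2 * T₀)) ∧
          ∀ (alg : LearningAlgorithm S A) (n : SSP S A → ℕ∞),
            alg.IsCorrect ε δ (sspClass S A cmin Tbar) n →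
            ENNReal.ofReal κ *
                (min (M₀.Bstar / ENNReal.ofReal cmin) Tbar * M₀.Bstar ^ 2 * S * A
                  * ENNReal.ofReal (1 / ε ^ 2 * Real.log (1 / δ)))
              ≤ (n M₀ : ℝ≥0∞) := by
  -- Replacing `Bstar` by `2 * B` and the minimum by `2 * K` costs a factor `8`, and `8 * 110592 <
  -- 1000000`.
  refine ⟨1 / 1000000, by norm_num, ?_⟩
  intro S A cmin B T Tbar ε δ hS hA hc hB hBT hlog hcT hTbar hfin hε hε' hδ hδ'
  have hT : 0 < T := by linarith
  have hB0 : 0 < B := by linarith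
  obtain ⟨K, hTK, hcK, hKT, hmin⟩ := exists_scale hc hB0 hT hcT hTbar hfin
  let p : HardParams S A := ⟨cmin, B, T, K, ε, hS, hA, hc, hB, hBT, hlog,
    (le_div_iff₀ hT).1 hcT, hTK, hcK, hε, hε'⟩
  refine ⟨p.inst 0, p.inst_mem_sspClass 0 hTbar hKT,
    ⟨le_trans (ENNReal.ofReal_le_ofReal ?_) p.le_Bstar, p.Bstar_le⟩,
    ⟨le_trans (ENNReal.ofReal_le_ofReal ?_) p.le_Tstar, p.Tstar_le⟩, fun alg n hn => ?_⟩
  · change B / 2 ≤ B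
    linarith
  · change T / 2 ≤ T
    linarith
  rcases hN : n (p.inst 0) with _ | N
  · exact le_top
  have h := p.le_queries hδ hδ' (fun g => p.inst_mem_sspClass g hTbar hKT) hn hN
  change K * B ^ 2 * S * A / ε ^ 2 * Real.log (1 / δ) ≤ 110592 * N at h
  have hmin' : min ((p.inst 0).Bstar / ENNReal.ofReal cmin) Tbar ≤ ENNReal.ofReal (2 * K) :=
    (min_le_min_right _ (ENNReal.div_le_div_right p.Bstar_le _)).trans hmin
  have hB2 : (p.inst 0).Bstar ^ 2 ≤ ENNReal.ofReal (2 * B) ^ 2 :=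
    pow_le_pow_left' p.Bstar_le 2
  calc _ ≤ ENNReal.ofReal (1 / 1000000) * (ENNReal.ofReal (2 * K) * ENNReal.ofReal (2 * B) ^ 2 *
          S * A * ENNReal.ofReal (1 / ε ^ 2 * Real.log (1 / δ))) := by gcongr
    _ = ENNReal.ofReal (1 / 1000000 * (2 * K * (2 * B) ^ 2 * S * A *
          (1 / ε ^ 2 * Real.log (1 / δ)))) := by
        have key : ∀ u v L : ℝ, 0 ≤ u → 0 ≤ v → ENNReal.ofReal u * ENNReal.ofReal v ^ 2 * S * A *
            ENNReal.ofReal L = ENNReal.ofReal (u * v ^ 2 * S * A * L) := fun u v L hu hv => by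
          rw [ENNReal.ofReal_mul (by positivity), ENNReal.ofReal_mul (by positivity),
            ENNReal.ofReal_mul (by positivity), ENNReal.ofReal_mul hu, ENNReal.ofReal_pow hv,
            ENNReal.ofReal_natCast, ENNReal.ofReal_natCast]
        rw [key _ _ _ (by linarith) (by linarith), ← ENNReal.ofReal_mul (by norm_num)]
    _ ≤ ENNReal.ofReal N := by
        refine ENNReal.ofReal_le_ofReal ?_
        have h1 : 1 / 1000000 * (2 * K * (2 * B) ^ 2 * S * A * (1 / ε ^ 2 * Real.log (1 / δ))) =
            8 / 1000000 * (K * B ^ 2 * S * A / ε ^ 2 * Real.log (1 / δ)) := by ring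
        rw [h1]
        linarith [(Nat.cast_nonneg N : (0 : ℝ) ≤ N)]
    _ = _ := by
        rw [ENNReal.ofReal_natCast]
        rfl
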